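/- Let $\mathcal H$ be a complex separable Hilbert space, $\mathcal K$ a complex Hilbert space and $F\colon\mathcal H\to\mathcal K$ a frame, that is, a Hilbert--Schmidt operator with trivial kernel and dense range. Let $H_0$ be a (possibly unbounded) self-adjoint operator on $\mathcal H$, let $J$ be a bounded self-adjoint operator on $\mathcal K$, and put $V=F^*JF$, $H_r=H_0+rV$ for $r\in\mathbb R$, and $R_z(H)=(H-z)^{-1}$. For $\lambda\in\mathbb R$, a self-adjoint operator $H$ is called regular at $\lambda$ if, as $y\to0^+$, the operators $F R_{\lambda+iy}(H)F^*$ converge in the operator norm and the operators $F\,\mathrm{Im}\,R_{\lambda+iy}(H)\,F^*$ converge in the trace-class norm, where $\mathrm{Im}\,R=(R-R^*)/(2i)$. The limit of the latter is denoted by $F\,\mathrm{Im}\,R_{\lambda+i0}(H)\,F^*$. The line $\{H_r : r\in\mathbb R\}$ is called regular at $\lambda$ if $H_r$ is regular at $\lambda$ for at least one $r\in\mathbb R$. Suppose that the line $\{H_r\}$ is regular at $\lambda$. For every real $s$ such that $H_s$ is regular at $\lambda$ set $$F_{\lambda+i0}(s)=\frac1\pi\,\mathrm{Tr}\bigl(\mathrm{Im}\,R_{\lambda+i0}(H_s)\,V\bigr):=\frac1\pi\,\mathrm{Tr}\bigl(F\,\mathrm{Im}\,R_{\lambda+i0}(H_s)\,F^*\,J\bigr).$$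 Then $F_{\lambda+i0}$ has a meromorphic continuation to the whole complex plane $\mathbb C$, and the residue of any such continuation at every $s_0\in\mathbb R$, in particular at every real pole, is equal to $0$. -/

import Mathlib

open Filter Topology
open scoped InnerProductSpace

namespace FramedHilbert

noncomputable section

variable {H K : Type*}
variable [NormedAddCommGroup H] [InnerProductSpace ℂ H]
variable [NormedAddCommGroup K] [InnerProductSpace ℂ K]

/-- `R` is the bounded two-sided inverse of `A - z`, for a possibly unbounded operator `A`. -/
def IsResolventAt (A : H →ₗ.[ℂ] H) (z : ℂ) (R : H →L[ℂ] H) : Prop :=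
  (∀ x : H, ∃ hx : R x ∈ A.domain, A ⟨R x, hx⟩ - z • R x = x) ∧
    ∀ x : A.domain, R (A x - z • (x : H)) = x

theorem IsResolventAt.unique {A : H →ₗ.[ℂ] H} {z : ℂ} {R S : H →L[ℂ] H}
    (hR : IsResolventAt A z R) (hS : IsResolventAt A z S) : R = S := by
  ext x
  obtain ⟨hx, h⟩ := hS.1 x
  have h2 := hR.2 ⟨S x, hx⟩
  rw [h] at h2
  exact h2

open Classical in
/-- The resolvent `R_z(A) = (A - z)⁻¹`. It is `0` by convention if `z` lies in the spectrum of `A`;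
for self-adjoint `A` it is only used at non-real `z`. -/
def resolventAt (A : H →ₗ.[ℂ] H) (z : ℂ) : H →L[ℂ] H :=
  if h : ∃ R, IsResolventAt A z R then h.choose else 0

theorem IsResolventAt.resolventAt_eq {A : H →ₗ.[ℂ] H} {z : ℂ} {R : H →L[ℂ] H}
    (hR : IsResolventAt A z R) : resolventAt A z = R := by
  have h : ∃ R, IsResolventAt A z R := ⟨R, hR⟩
  rw [resolventAt, dif_pos h]
  exact h.choose_spec.unique hR

/-- The trace norm of a bounded operator, with value `∞` if the operator is not trace class:
the supremum of `∑ᵢ |⟨fᵢ, T eᵢ⟩|` over all pairs of finite orthonormal families `e`, `f`.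
This is the sum of the singular values of `T`, that is, the trace of `|T|`. -/
def traceNorm (T : K →L[ℂ] K) : ENNReal :=
  ⨆ (n : ℕ) (e : Fin n → K) (f : Fin n → K) (_ : Orthonormal ℂ e) (_ : Orthonormal ℂ f),
    ∑ i, ‖⟪f i, T (e i)⟫_ℂ‖ₑ

def IsTraceClass (T : K →L[ℂ] K) : Prop := traceNorm T < ⊤

/-- The trace, computed in some orthonormal basis; for trace class operators the series converges
absolutely and its sum does not depend on the basis. -/
def trace [CompleteSpace K] (T : K →L[ℂ] K) : ℂ :=
  let b := (exists_hilbertBasis ℂ K).choose_spec.choose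
  ∑' i, ⟪b i, T (b i)⟫_ℂ

def IsHilbertSchmidt (F : H →L[ℂ] K) : Prop :=
  ∃ (w : Set H) (b : HilbertBasis w ℂ H), Summable fun i => ‖F (b i)‖ ^ 2

/-- A frame: a Hilbert-Schmidt operator with trivial kernel and trivial co-kernel. -/
structure IsFrame (F : H →L[ℂ] K) : Prop where
  hilbertSchmidt : IsHilbertSchmidt F
  injective : Function.Injective F
  denseRange : DenseRange F

variable [CompleteSpace H] [CompleteSpace K]

/-- The sandwiched resolvent `T_z(A) = F R_z(A) F*`. -/
def sandwich (F : H →L[ℂ] K) (A : H →ₗ.[ℂ] H) (z : ℂ) : K →L[ℂ] K :=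
  F ∘L resolventAt A z ∘L F.adjoint

/-- `F (Im R_z(A)) F*`, where `Im R = (R - R*) / (2i)`. -/
def sandwichIm (F : H →L[ℂ] K) (A : H →ₗ.[ℂ] H) (z : ℂ) : K →L[ℂ] K :=
  F ∘L (imaginaryPart (resolventAt A z) : H →L[ℂ] H) ∘L F.adjoint

/-- `A` is regular at `lam`: as `y → 0⁺`, `F R_{lam+iy}(A) F*` converges in the operator norm and
`F (Im R_{lam+iy}(A)) F*` converges in the trace norm. -/
structure IsRegularAt (F : H →L[ℂ] K) (A : H →ₗ.[ℂ] H) (lam : ℝ) : Prop where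
  exists_limit : ∃ T : K →L[ℂ] K,
    Tendsto (fun y : ℝ => sandwich F A (lam + y * Complex.I)) (𝓝[>] 0) (𝓝 T)
  exists_limit_im : ∃ B : K →L[ℂ] K, IsTraceClass B ∧
    Tendsto (fun y : ℝ => traceNorm (sandwichIm F A (lam + y * Complex.I) - B)) (𝓝[>] 0) (𝓝 0)

/-- `F (Im R_{lam+i0}(A)) F*`, meaningful if `A` is regular at `lam`. The limit is taken in the
operator norm; it is then also the limit in the (stronger) trace norm. -/
def boundaryIm (F : H →L[ℂ] K) (A : H →ₗ.[ℂ] H) (lam : ℝ) : K →L[ℂ] K :=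
  limUnder (𝓝[>] (0 : ℝ)) fun y : ℝ => sandwichIm F A (lam + y * Complex.I)

/-- The perturbation `V = F* J F`. -/
def perturbation (F : H →L[ℂ] K) (J : K →L[ℂ] K) : H →L[ℂ] H :=
  F.adjoint ∘L J ∘L F

/-- The operator `H_r = H₀ + r V` on the domain of `H₀`. -/
def line (F : H →L[ℂ] K) (J : K →L[ℂ] K) (H₀ : H →ₗ.[ℂ] H) (r : ℝ) : H →ₗ.[ℂ] H :=
  (((r : ℂ) • perturbation F J : H →L[ℂ] H) : H →ₗ[ℂ] H) +ᵥ H₀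

/-- The line `{H_r}` is regular at `lam`: it is not contained in the set of operators which are
resonant (that is, not regular) at `lam`. -/
def IsRegularLine (F : H →L[ℂ] K) (J : K →L[ℂ] K) (H₀ : H →ₗ.[ℂ] H) (lam : ℝ) : Prop :=
  ∃ r : ℝ, IsRegularAt F (line F J H₀ r) lam

/-- `F_{lam+i0}(r) = (1/π) Tr (Im R_{lam+i0}(H_r) V)` for real `r` such that `H_r` is regular at
`lam`. The boundary value `R_{lam+i0}(H_r)` exists only between the rigging spaces `H_1` (the range
of `F*`) and `H_{-1}` (the completion of `H` in the norm `‖F x‖`), both of which `F` identifies with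
`K`; in this identification `Im R_{lam+i0}(H_r)` is `F (Im R_{lam+i0}(H_r)) F*` and `V` is `J`. -/
def boundaryTrace (F : H →L[ℂ] K) (J : K →L[ℂ] K) (H₀ : H →ₗ.[ℂ] H) (lam r : ℝ) : ℂ :=
  (1 / Real.pi : ℂ) * trace (boundaryIm F (line F J H₀ r) lam ∘L J)

/-- `G` is a meromorphic function on the complex plane which continues `r ↦ F_{lam+i0}(r)` from the
real non-resonant values of the coupling constant. -/
structure IsMeromorphicContinuation (F : H →L[ℂ] K) (J : K →L[ℂ] K) (H₀ : H →ₗ.[ℂ] H) (lam : ℝ)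
    (G : ℂ → ℂ) : Prop where
  meromorphic : Meromorphic G
  eq_boundaryTrace : ∀ r : ℝ, IsRegularAt F (line F J H₀ r) lam →
    G r = boundaryTrace F J H₀ lam r

end

/-- `G` has residue `c` at `a`: `(2πi)⁻¹ ∮ G = c` over all small circles around `a`. -/
def HasResidueAt (G : ℂ → ℂ) (a c : ℂ) : Prop :=
  ∀ᶠ ε in 𝓝[>] (0 : ℝ), (2 * Real.pi * Complex.I : ℂ)⁻¹ * (∮ s in C(a, ε), G s) = c

end FramedHilbert

/-! Fix `r` with `H_r` regular at `lam`, and let `T` be the norm limit of `F R_{lam+iy}(H_r) F*`; it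
is compact because `F` is Hilbert-Schmidt. For regular `s`, the second resolvent identity gives the
limit at `s` as `T L` with `L = (1 + (s-r) J T)⁻¹`, and `Im (T L) = L* (Im T) L`
(`imaginaryPart_mul_inverse`). Since `Im T` is nonnegative and trace class, `Im T = S S` with `S`
Hilbert-Schmidt, and cyclicity gives `Tr (L* S S L J) = Tr (S L J L* S)`. For real `s` the factor
`L*` is `(1 + (s-r) T* J)⁻¹`, which makes sense for complex `s` without conjugating it. So the trace
is a norm-continuous functional (`vectorTrace`) of `resolventProduct`, an operator function that is
meromorphic on the plane by analytic Fredholm theory (`boundaryTrace_eq`,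
`IsCompactOperator.meromorphicAt_inverse`).

For the residue, suppose first that `T` and `J` are matrices `t` and `j`. Up to a constant the
function is `tr (j t (1 + s j t)⁻¹) - tr (t* j (1 + s t* j)⁻¹)`: the logarithmic derivative of `det
(1 + s j t)` minus that of its complex conjugate. Over a circle centred on the real axis both
integrals equal `2πi N`, where `N` counts the zeros inside, and they cancel
(`circleIntegral_trace_mul_sub_conjTranspose`). In general `T` is replaced by its compression to a
large finite-dimensional subspace. This perturbs the integrand by a small amount uniformly on any
circle free of poles, so the integral for `T` itself is zero (`circleIntegral_vectorTrace_eq_zero`).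

Any other continuation agrees with this one near every point, up to isolated values: the regular `s`
contain a neighbourhood of `r` (`isRegularAt_of_isUnit`), so the identity theorem applies. -/

namespace FramedHilbert

/-! ### The trace norm and its ideal property. -/

section TraceNorm

variable {K : Type*} [NormedAddCommGroup K] [InnerProductSpace ℂ K]

theorem sum_enorm_inner_le_traceNorm (T : K →L[ℂ] K) {n : ℕ} {e f : Fin n → K}
    (he : Orthonormal ℂ e) (hf : Orthonormal ℂ f) :
    ∑ i, ‖⟪f i, T (e i)⟫_ℂ‖ₑ ≤ traceNorm T :=
  le_iSup_of_le n <| le_iSup_of_le e <| le_iSup_of_le f <| le_iSup_of_le he <|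
    le_iSup_of_le hf le_rfl

theorem traceNorm_le_iff {T : K →L[ℂ] K} {c : ENNReal} :
    traceNorm T ≤ c ↔ ∀ (n : ℕ) (e f : Fin n → K), Orthonormal ℂ e → Orthonormal ℂ f →
      ∑ i, ‖⟪f i, T (e i)⟫_ℂ‖ₑ ≤ c := by
  simp only [traceNorm, iSup_le_iff]

theorem enorm_inner_le_traceNorm (T : K →L[ℂ] K) {x y : K} (hx : ‖x‖ = 1) (hy : ‖y‖ = 1) :
    ‖⟪y, T x⟫_ℂ‖ₑ ≤ traceNorm T := by
  have h := sum_enorm_inner_le_traceNorm T (n := 1) (e := fun _ => x) (f := fun _ => y)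
    ⟨fun _ => hx, fun i j hij => (hij (Subsingleton.elim i j)).elim⟩
    ⟨fun _ => hy, fun i j hij => (hij (Subsingleton.elim i j)).elim⟩
  simpa using h

theorem traceNorm_add_le (A B : K →L[ℂ] K) : traceNorm (A + B) ≤ traceNorm A + traceNorm B := by
  refine traceNorm_le_iff.2 fun n e f he hf => ?_
  calc ∑ i, ‖⟪f i, (A + B) (e i)⟫_ℂ‖ₑ
      ≤ ∑ i, (‖⟪f i, A (e i)⟫_ℂ‖ₑ + ‖⟪f i, B (e i)⟫_ℂ‖ₑ) := by
        refine Finset.sum_le_sum fun i _ => ?_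
        rw [add_apply, inner_add_right]
        exact enorm_add_le _ _
    _ ≤ _ := by
        rw [Finset.sum_add_distrib]
        exact add_le_add (sum_enorm_inner_le_traceNorm A he hf)
          (sum_enorm_inner_le_traceNorm B he hf)

theorem traceNorm_zero : traceNorm (0 : K →L[ℂ] K) = 0 :=
  le_antisymm (traceNorm_le_iff.2 fun n e f he hf => by simp) bot_le

theorem traceNorm_sum_le {ι : Type*} (s : Finset ι) (A : ι → K →L[ℂ] K) :
    traceNorm (∑ i ∈ s, A i) ≤ ∑ i ∈ s, traceNorm (A i) := by
  classical
  induction s using Finset.induction_on with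
  | empty => simp [traceNorm_zero]
  | insert a s ha ih =>
    rw [Finset.sum_insert ha, Finset.sum_insert ha]
    exact (traceNorm_add_le _ _).trans (by gcongr)

theorem traceNorm_smul_le (c : ℂ) (A : K →L[ℂ] K) : traceNorm (c • A) ≤ ‖c‖ₑ * traceNorm A := by
  refine traceNorm_le_iff.2 fun n e f he hf => ?_
  simp only [smul_apply, inner_smul_right, enorm_mul, ← Finset.mul_sum]
  gcongr
  exact sum_enorm_inner_le_traceNorm A he hf

variable [CompleteSpace K]

theorem orthonormal_comp_of_mem_unitary {u : K →L[ℂ] K} (hu : u ∈ unitary (K →L[ℂ] K)) {n : ℕ}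
    {e : Fin n → K} (he : Orthonormal ℂ e) : Orthonormal ℂ fun i => u (e i) := by
  rw [orthonormal_iff_ite] at he ⊢
  intro i j
  rw [← ContinuousLinearMap.adjoint_inner_right, ← he i j]
  have h := (Unitary.mem_iff.1 hu).1
  rw [ContinuousLinearMap.star_eq_adjoint] at h
  have h2 := congrArg (fun T : K →L[ℂ] K => T (e j)) h
  simp only [mul_apply_eq_comp, one_apply_eq_self] at h2
  rw [h2]

theorem traceNorm_unitary_mul_le {u : K →L[ℂ] K} (hu : u ∈ unitary (K →L[ℂ] K))
    (A : K →L[ℂ] K) : traceNorm (u * A) ≤ traceNorm A := by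
  refine traceNorm_le_iff.2 fun n e f he hf => ?_
  refine le_of_eq_of_le (Finset.sum_congr rfl fun i _ => ?_) (sum_enorm_inner_le_traceNorm A he
    (orthonormal_comp_of_mem_unitary (Unitary.star_mem hu) hf))
  rw [mul_apply_eq_comp, ContinuousLinearMap.star_eq_adjoint,
    ContinuousLinearMap.adjoint_inner_left]

theorem traceNorm_mul_unitary_le {u : K →L[ℂ] K} (hu : u ∈ unitary (K →L[ℂ] K))
    (A : K →L[ℂ] K) : traceNorm (A * u) ≤ traceNorm A :=
  traceNorm_le_iff.2 fun _ _ _ he hf => sum_enorm_inner_le_traceNorm A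
    (orthonormal_comp_of_mem_unitary hu he) hf

theorem sum_enorm_mul_le {x : K →L[ℂ] K} {c : Fin 4 → ℂ} (h : ∀ i, ‖c i‖ ≤ ‖x‖ / 2)
    (t : ENNReal) : ∑ i, ‖c i‖ₑ * t ≤ 2 * ‖x‖ₑ * t := by
  rw [← Finset.sum_mul]
  gcongr
  have h4 : ∑ i, ‖c i‖ₑ ≤ ∑ _i : Fin 4, (‖x‖ₑ / 2) := by
    refine Finset.sum_le_sum fun i _ => ?_
    rw [ENNReal.le_div_iff_mul_le (by simp) (by simp), ← ofReal_norm, ← ofReal_norm,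
      show (2 : ENNReal) = ENNReal.ofReal 2 by simp, ← ENNReal.ofReal_mul (by positivity)]
    exact ENNReal.ofReal_le_ofReal (by linarith [h i])
  refine h4.trans (le_of_eq ?_)
  rw [Finset.sum_const, Finset.card_univ, Fintype.card_fin, nsmul_eq_mul,
    show ((4 : ℕ) : ENNReal) = 2 * 2 by norm_num, mul_assoc, ENNReal.mul_div_cancel (by simp) (by simp)]

/-- The ideal property of the trace norm. The constant is not optimal. -/
theorem traceNorm_mul_le_left (X A : K →L[ℂ] K) :
    traceNorm (X * A) ≤ 2 * ‖X‖ₑ * traceNorm A := by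
  -- A unitary carries orthonormal families to orthonormal families, so multiplying by it cannot
  -- increase the trace norm. Writing `X` as a combination of four unitaries with coefficients at
  -- most `‖X‖ / 2` gives the constant `2`.
  obtain ⟨u, c, hX, hc⟩ := CStarAlgebra.exists_sum_four_unitary X
  refine le_trans ?_ (sum_enorm_mul_le hc (traceNorm A))
  have : X * A = ∑ i, c i • ((u i : K →L[ℂ] K) * A) := by
    conv_lhs => rw [hX]
    simp only [Finset.sum_mul, smul_mul_assoc]
  rw [this]
  refine (traceNorm_sum_le _ _).trans (Finset.sum_le_sum fun i _ => ?_)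
  refine (traceNorm_smul_le _ _).trans ?_
  gcongr
  exact traceNorm_unitary_mul_le (u i).2 A

theorem traceNorm_mul_le_right (A X : K →L[ℂ] K) :
    traceNorm (A * X) ≤ 2 * ‖X‖ₑ * traceNorm A := by
  obtain ⟨u, c, hX, hc⟩ := CStarAlgebra.exists_sum_four_unitary X
  refine le_trans ?_ (sum_enorm_mul_le hc (traceNorm A))
  have : A * X = ∑ i, c i • (A * (u i : K →L[ℂ] K)) := by
    conv_lhs => rw [hX]
    simp only [Finset.mul_sum, mul_smul_comm]
  rw [this]
  refine (traceNorm_sum_le _ _).trans (Finset.sum_le_sum fun i _ => ?_)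
  refine (traceNorm_smul_le _ _).trans ?_
  gcongr
  exact traceNorm_mul_unitary_le (u i).2 A

theorem IsTraceClass.mul_mul {A : K →L[ℂ] K} (hA : IsTraceClass A) (X Y : K →L[ℂ] K) :
    IsTraceClass (X * A * Y) := by
  refine (traceNorm_mul_le_right _ _).trans_lt (ENNReal.mul_lt_top (by simp [ENNReal.mul_lt_top_iff]) ?_)
  exact (traceNorm_mul_le_left _ _).trans_lt (ENNReal.mul_lt_top (by simp [ENNReal.mul_lt_top_iff]) hA)

/-- The trace-norm limit is preserved by multiplication with norm-convergent factors. -/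
theorem tendsto_traceNorm_mul_mul {ι : Type*} {l : Filter ι} {X Y A : ι → K →L[ℂ] K}
    {X₀ Y₀ A₀ : K →L[ℂ] K} (hX : Tendsto X l (𝓝 X₀)) (hY : Tendsto Y l (𝓝 Y₀))
    (hA₀ : IsTraceClass A₀) (hA : Tendsto (fun i => traceNorm (A i - A₀)) l (𝓝 0)) :
    Tendsto (fun i => traceNorm (X i * A i * Y i - X₀ * A₀ * Y₀)) l (𝓝 0) := by
  have hXn : Tendsto (fun i => ‖X i‖ₑ) l (𝓝 ‖X₀‖ₑ) := (continuous_enorm.tendsto _).comp hX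
  have hYn : Tendsto (fun i => ‖Y i‖ₑ) l (𝓝 ‖Y₀‖ₑ) := (continuous_enorm.tendsto _).comp hY
  have hXd : Tendsto (fun i => ‖X i - X₀‖ₑ) l (𝓝 0) := by
    simpa [Function.comp_def] using (continuous_enorm.tendsto (X₀ - X₀)).comp (hX.sub_const X₀)
  have hYd : Tendsto (fun i => ‖Y i - Y₀‖ₑ) l (𝓝 0) := by
    simpa [Function.comp_def] using (continuous_enorm.tendsto (Y₀ - Y₀)).comp (hY.sub_const Y₀)
  have hb : ∀ i, traceNorm (X i * A i * Y i - X₀ * A₀ * Y₀) ≤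
      2 * ‖Y i‖ₑ * (2 * ‖X i‖ₑ * traceNorm (A i - A₀)) +
      (2 * ‖Y i‖ₑ * (2 * ‖X i - X₀‖ₑ * traceNorm A₀) +
        2 * ‖Y i - Y₀‖ₑ * (2 * ‖X₀‖ₑ * traceNorm A₀)) := by
    intro i
    have : X i * A i * Y i - X₀ * A₀ * Y₀ =
        X i * (A i - A₀) * Y i + ((X i - X₀) * A₀ * Y i + X₀ * A₀ * (Y i - Y₀)) := by
      simp only [mul_sub, sub_mul]; abel
    rw [this]
    refine (traceNorm_add_le _ _).trans (add_le_add ?_ ((traceNorm_add_le _ _).trans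
      (add_le_add ?_ ?_)))
    all_goals
      refine (traceNorm_mul_le_right _ _).trans ?_
      gcongr
      exact traceNorm_mul_le_left _ _
  have hA₀' : traceNorm A₀ ≠ ⊤ := hA₀.ne
  refine tendsto_of_tendsto_of_tendsto_of_le_of_le tendsto_const_nhds ?_ (fun _ => bot_le) hb
  have h2 : (2 : ENNReal) ≠ ⊤ := by simp
  have z1 := ENNReal.Tendsto.mul (ENNReal.Tendsto.const_mul hYn (Or.inr h2)) (Or.inr (by simp))
    (ENNReal.Tendsto.mul (ENNReal.Tendsto.const_mul hXn (Or.inr h2)) (Or.inr (by simp)) hA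
      (Or.inr (ENNReal.mul_ne_top h2 enorm_ne_top)))
    (Or.inr (ENNReal.mul_ne_top h2 enorm_ne_top))
  have z2 := ENNReal.Tendsto.mul (ENNReal.Tendsto.const_mul hYn (Or.inr h2)) (Or.inr (by simp))
    (ENNReal.Tendsto.mul_const (b := traceNorm A₀)
      (ENNReal.Tendsto.const_mul hXd (Or.inr h2)) (Or.inr hA₀'))
    (Or.inr (ENNReal.mul_ne_top h2 enorm_ne_top))
  have z3 := ENNReal.Tendsto.mul_const (b := 2 * ‖X₀‖ₑ * traceNorm A₀)
    (ENNReal.Tendsto.const_mul hYd (Or.inr h2))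
    (Or.inr (ENNReal.mul_ne_top (ENNReal.mul_ne_top h2 enorm_ne_top) hA₀'))
  simpa using z1.add (z2.add z3)

end TraceNorm

/-! ### Resolvents of self-adjoint operators along the line. -/

section Resolvent

variable {H K : Type*} [NormedAddCommGroup H] [InnerProductSpace ℂ H]
  [NormedAddCommGroup K] [InnerProductSpace ℂ K]

/-- A symmetric operator which contains every pair `(y, w)` in the graph of its adjoint. -/
structure IsMaximalSymmetric (A : H →ₗ.[ℂ] H) : Prop where
  symm : ∀ x y : A.domain, ⟪A x, (y : H)⟫_ℂ = ⟪(x : H), A y⟫_ℂ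
  maximal : ∀ y w : H, (∀ x : A.domain, ⟪y, A x⟫_ℂ = ⟪w, (x : H)⟫_ℂ) →
    ∃ hy : y ∈ A.domain, A ⟨y, hy⟩ = w

theorem _root_.IsSelfAdjoint.isMaximalSymmetric [CompleteSpace H] {A : H →ₗ.[ℂ] H}
    (hA : IsSelfAdjoint A) : IsMaximalSymmetric A := by
  have hd := hA.dense_domain
  have hA' : A.adjoint = A := LinearPMap.isSelfAdjoint_def.1 hA
  have hf := LinearPMap.adjoint_isFormalAdjoint hd
  refine ⟨fun x y => ?_, fun y w h => ?_⟩
  · rw [hA'] at hf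
    exact hf x y
  · have hy : y ∈ A.adjoint.domain :=
      LinearPMap.mem_adjoint_domain_of_exists y ⟨w, fun x => (h x).symm⟩
    have hw : A.adjoint ⟨y, hy⟩ = w := LinearPMap.adjoint_apply_eq hd _ fun x => (h x).symm
    -- The proof that `y` lies in the domain depends on the operator, so `A.adjoint = A` is used by
    -- generalizing the operator first.
    have key : ∀ A' : H →ₗ.[ℂ] H, A' = A → ∀ hy : y ∈ A'.domain, A' ⟨y, hy⟩ = w →
        ∃ hy : y ∈ A.domain, A ⟨y, hy⟩ = w := by
      rintro _ rfl hy hw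
      exact ⟨hy, hw⟩
    exact key _ hA' hy hw

/-- This stability makes the property usable for every `H_r`: it suffices for constructing
resolvents, so self-adjointness of `H_r` itself is not needed. -/
theorem IsMaximalSymmetric.vadd [CompleteSpace H] {A : H →ₗ.[ℂ] H} (hA : IsMaximalSymmetric A)
    {B : H →L[ℂ] H} (hB : IsSelfAdjoint B) : IsMaximalSymmetric ((B : H →ₗ[ℂ] H) +ᵥ A) := by
  have hBs : ∀ x y : H, ⟪B x, y⟫_ℂ = ⟪x, B y⟫_ℂ := hB.isSymmetric
  refine ⟨fun x y => ?_, fun y w h => ?_⟩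
  · change ⟪B x + A x, (y : H)⟫_ℂ = ⟪(x : H), B y + A y⟫_ℂ
    rw [inner_add_left, inner_add_right, hBs, hA.symm x y]
  · obtain ⟨hy, hw⟩ := hA.maximal y (w - B y) fun x => by
      have h1 : ⟪y, B x + A x⟫_ℂ = ⟪w, (x : H)⟫_ℂ := h x
      rw [inner_add_right] at h1
      rw [inner_sub_left, hBs, ← h1]
      ring
    refine ⟨hy, ?_⟩
    change B y + A ⟨y, hy⟩ = w
    rw [hw]; abel

theorem IsMaximalSymmetric.inner_self_im {A : H →ₗ.[ℂ] H} (hA : IsMaximalSymmetric A)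
    (x : A.domain) : (⟪(x : H), A x⟫_ℂ).im = 0 := by
  rw [← Complex.conj_eq_iff_im, inner_conj_symm, hA.symm]

theorem IsMaximalSymmetric.inner_sub_smul_im {A : H →ₗ.[ℂ] H} (hA : IsMaximalSymmetric A)
    (z : ℂ) (x : A.domain) :
    (⟪(x : H), A x - z • (x : H)⟫_ℂ).im = -z.im * ‖(x : H)‖ ^ 2 := by
  rw [inner_sub_right, inner_smul_right, Complex.sub_im, hA.inner_self_im,
    inner_self_eq_norm_sq_to_K]
  simp [← Complex.ofReal_pow]

theorem IsMaximalSymmetric.norm_le {A : H →ₗ.[ℂ] H} (hA : IsMaximalSymmetric A)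
    (z : ℂ) (x : A.domain) : |z.im| * ‖(x : H)‖ ≤ ‖A x - z • (x : H)‖ := by
  rcases eq_or_ne (x : H) 0 with h | h
  · simp [h]
  · have h0 : 0 < ‖(x : H)‖ := norm_pos_iff.2 h
    have h1 := Complex.abs_im_le_norm ⟪(x : H), A x - z • (x : H)⟫_ℂ
    rw [hA.inner_sub_smul_im, abs_mul, abs_neg, abs_of_nonneg (sq_nonneg ‖(x : H)‖)] at h1
    have h2 := h1.trans (norm_inner_le_norm _ _)
    refine le_of_mul_le_mul_left ?_ h0
    linarith [h2, show ‖(x : H)‖ * (|z.im| * ‖(x : H)‖) = |z.im| * ‖(x : H)‖ ^ 2 by ring]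

/-- The operator `A - z` as a linear map on the domain of `A`. -/
def subSMulLinear (A : H →ₗ.[ℂ] H) (z : ℂ) : A.domain →ₗ[ℂ] H :=
  A.toFun - z • A.domain.subtype

theorem subSMulLinear_apply (A : H →ₗ.[ℂ] H) (z : ℂ) (x : A.domain) :
    subSMulLinear A z x = A x - z • (x : H) := rfl

/-- By `IsMaximalSymmetric.norm_le`, preimages of a convergent sequence are Cauchy; maximality
places their limit in the domain, because the defining pairing passes to the limit. -/
theorem IsMaximalSymmetric.isClosed_range [CompleteSpace H] {A : H →ₗ.[ℂ] H}
    (hA : IsMaximalSymmetric A) {z : ℂ} (hz : z.im ≠ 0) :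
    IsClosed ((LinearMap.range (subSMulLinear A z) : Submodule ℂ H) : Set H) := by
  refine isClosed_of_closure_subset fun y hy => ?_
  obtain ⟨v, hv, hvy⟩ := mem_closure_iff_seq_limit.1 hy
  choose x hx using hv
  have hc : CauchySeq fun n => (x n : H) := by
    have hvc := hvy.cauchySeq
    rw [Metric.cauchySeq_iff'] at hvc ⊢
    intro ε hε
    obtain ⟨N, hN⟩ := hvc (|z.im| * ε) (by positivity)
    refine ⟨N, fun n hn => ?_⟩
    have h1 := hN n hn
    rw [dist_eq_norm, ← hx, ← hx, ← map_sub, subSMulLinear_apply] at h1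
    have h2 := (hA.norm_le z (x n - x N)).trans_lt h1
    rw [dist_eq_norm]
    exact lt_of_mul_lt_mul_left h2 (abs_nonneg _)
  obtain ⟨x₀, hx₀⟩ := cauchySeq_tendsto_of_complete hc
  have hAx : ∀ n, A (x n) = v n + z • (x n : H) := fun n => by
    rw [← hx n, subSMulLinear_apply]; abel
  have hAt : Tendsto (fun n => A (x n)) atTop (𝓝 (y + z • x₀)) := by
    simp only [hAx]
    exact hvy.add (hx₀.const_smul z)
  obtain ⟨h0, h1⟩ := hA.maximal x₀ (y + z • x₀) fun u => by
    have e1 : Tendsto (fun n => ⟪(x n : H), A u⟫_ℂ) atTop (𝓝 ⟪x₀, A u⟫_ℂ) :=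
      hx₀.inner tendsto_const_nhds
    have e2 : Tendsto (fun n => ⟪A (x n), (u : H)⟫_ℂ) atTop (𝓝 ⟪y + z • x₀, (u : H)⟫_ℂ) :=
      hAt.inner tendsto_const_nhds
    simp only [hA.symm] at e2
    exact tendsto_nhds_unique e1 e2
  refine ⟨⟨x₀, h0⟩, ?_⟩
  rw [subSMulLinear_apply, h1]
  simp

/-- A vector orthogonal to the range is, by maximality, an eigenvector for the nonreal number `conj
z`, and the lower bound forces it to vanish. -/
theorem IsMaximalSymmetric.range_eq_top [CompleteSpace H] {A : H →ₗ.[ℂ] H}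
    (hA : IsMaximalSymmetric A) {z : ℂ} (hz : z.im ≠ 0) :
    LinearMap.range (subSMulLinear A z) = ⊤ := by
  have hcl := hA.isClosed_range hz
  have : CompleteSpace (LinearMap.range (subSMulLinear A z)) := hcl.completeSpace_coe
  rw [← Submodule.orthogonal_eq_bot_iff, Submodule.eq_bot_iff]
  intro w hw
  obtain ⟨h0, h1⟩ := hA.maximal w ((starRingEnd ℂ) z • w) fun x => by
    have := Submodule.inner_left_of_mem_orthogonal (LinearMap.mem_range_self (subSMulLinear A z) x) hw
    rw [subSMulLinear_apply, inner_sub_right, inner_smul_right, sub_eq_zero] at this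
    rw [this, inner_smul_left, Complex.conj_conj]
  have h2 := hA.norm_le ((starRingEnd ℂ) z) ⟨w, h0⟩
  rw [h1] at h2
  simp only [Complex.conj_im, abs_neg, sub_self, norm_zero] at h2
  have : 0 < |z.im| := abs_pos.2 hz
  exact norm_le_zero_iff.1 (by nlinarith [norm_nonneg w])

theorem IsMaximalSymmetric.exists_isResolventAt [CompleteSpace H] {A : H →ₗ.[ℂ] H}
    (hA : IsMaximalSymmetric A) {z : ℂ} (hz : z.im ≠ 0) : ∃ R, IsResolventAt A z R := by
  have hpos : 0 < |z.im| := abs_pos.2 hz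
  have hinj : Function.Injective (subSMulLinear A z) := by
    rw [← LinearMap.ker_eq_bot, LinearMap.ker_eq_bot']
    intro x hx
    have h := hA.norm_le z x
    rw [← subSMulLinear_apply, hx, norm_zero] at h
    exact Subtype.ext (norm_le_zero_iff.1 (by nlinarith [norm_nonneg (x : H)]))
  let e := LinearEquiv.ofBijective (subSMulLinear A z)
    ⟨hinj, LinearMap.range_eq_top.1 (hA.range_eq_top hz)⟩
  have he : ∀ x, A (e.symm x) - z • (e.symm x : H) = x := fun x => e.apply_symm_apply x
  refine ⟨LinearMap.mkContinuous (A.domain.subtype ∘ₗ e.symm.toLinearMap) |z.im|⁻¹ fun x => ?_,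
    fun x => ⟨(e.symm x).2, he x⟩, fun x => congrArg Subtype.val (e.symm_apply_apply x)⟩
  have h := hA.norm_le z (e.symm x)
  rw [he] at h
  rw [inv_mul_eq_div, le_div_iff₀' hpos]
  exact h

theorem IsMaximalSymmetric.isResolventAt [CompleteSpace H] {A : H →ₗ.[ℂ] H}
    (hA : IsMaximalSymmetric A) {z : ℂ} (hz : z.im ≠ 0) :
    IsResolventAt A z (resolventAt A z) := by
  obtain ⟨R, hR⟩ := hA.exists_isResolventAt hz
  rwa [hR.resolventAt_eq]

/-- With `u = R x`, the pairing `⟪(A - z) u, u⟫` has imaginary part `z.im * ‖u‖ ^ 2`. -/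
theorem IsMaximalSymmetric.inner_resolventAt_im_nonneg [CompleteSpace H] {A : H →ₗ.[ℂ] H}
    (hA : IsMaximalSymmetric A) {z : ℂ} (hz : 0 < z.im) (x : H) :
    0 ≤ (⟪x, resolventAt A z x⟫_ℂ).im := by
  obtain ⟨hx, h⟩ := (hA.isResolventAt hz.ne').1 x
  have h1 := hA.inner_sub_smul_im z ⟨_, hx⟩
  rw [h, ← inner_conj_symm, Complex.conj_im] at h1
  simp only at h1
  have := mul_nonneg hz.le (sq_nonneg ‖resolventAt A z x‖)
  linarith

variable [CompleteSpace H] [CompleteSpace K]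

theorem isSelfAdjoint_perturbation (F : H →L[ℂ] K) {J : K →L[ℂ] K} (hJ : IsSelfAdjoint J) :
    IsSelfAdjoint (perturbation F J) := by
  rw [perturbation]
  exact hJ.adjoint_conj F

theorem isMaximalSymmetric_line (F : H →L[ℂ] K) {J : K →L[ℂ] K} (hJ : IsSelfAdjoint J)
    {H₀ : H →ₗ.[ℂ] H} (hH₀ : IsSelfAdjoint H₀) (r : ℝ) : IsMaximalSymmetric (line F J H₀ r) := by
  refine hH₀.isMaximalSymmetric.vadd ?_
  refine IsSelfAdjoint.smul ?_ (isSelfAdjoint_perturbation F hJ)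
  exact Complex.conj_ofReal r

/-- The second resolvent identity along the line. -/
theorem resolventAt_line (F : H →L[ℂ] K) {J : K →L[ℂ] K} (hJ : IsSelfAdjoint J)
    {H₀ : H →ₗ.[ℂ] H} (hH₀ : IsSelfAdjoint H₀) (r s : ℝ) {z : ℂ} (hz : z.im ≠ 0) :
    resolventAt (line F J H₀ s) z = resolventAt (line F J H₀ r) z -
      ((s - r : ℝ) : ℂ) • (resolventAt (line F J H₀ r) z ∘L perturbation F J ∘L
        resolventAt (line F J H₀ s) z) := by
  ext x
  obtain ⟨hx, h⟩ := ((isMaximalSymmetric_line F hJ hH₀ s).isResolventAt hz).1 x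
  have h2 := ((isMaximalSymmetric_line F hJ hH₀ r).isResolventAt hz).2 ⟨_, hx⟩
  set u := resolventAt (line F J H₀ s) z x
  have hs : (line F J H₀ s) ⟨u, hx⟩ = (s : ℂ) • perturbation F J u + H₀ ⟨u, hx⟩ := rfl
  have hr : (line F J H₀ r) ⟨u, hx⟩ = (r : ℂ) • perturbation F J u + H₀ ⟨u, hx⟩ := rfl
  have h3 : (line F J H₀ r) ⟨u, hx⟩ - z • u = x - ((s - r : ℝ) : ℂ) • perturbation F J u := by
    rw [← h, hs, hr]
    push_cast
    module
  simp only at h2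
  rw [h3, map_sub, map_smul] at h2
  exact h2.symm

theorem sandwich_line (F : H →L[ℂ] K) {J : K →L[ℂ] K} (hJ : IsSelfAdjoint J)
    {H₀ : H →ₗ.[ℂ] H} (hH₀ : IsSelfAdjoint H₀) (r s : ℝ) {z : ℂ} (hz : z.im ≠ 0) :
    sandwich F (line F J H₀ s) z = sandwich F (line F J H₀ r) z -
      ((s - r : ℝ) : ℂ) • (sandwich F (line F J H₀ r) z * J * sandwich F (line F J H₀ s) z) := by
  conv_lhs => rw [sandwich, resolventAt_line F hJ hH₀ r s hz]
  ext x
  simp [sandwich, perturbation]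

theorem sandwichIm_eq (F : H →L[ℂ] K) (A : H →ₗ.[ℂ] H) (z : ℂ) :
    sandwichIm F A z = (imaginaryPart (sandwich F A z) : K →L[ℂ] K) := by
  rw [sandwichIm, imaginaryPart_apply_coe, imaginaryPart_apply_coe]
  simp only [sandwich, ContinuousLinearMap.star_eq_adjoint, ContinuousLinearMap.adjoint_comp,
    ContinuousLinearMap.adjoint_adjoint]
  ext x
  simp

theorem inner_sandwich_im_nonneg (F : H →L[ℂ] K) {A : H →ₗ.[ℂ] H} (hA : IsMaximalSymmetric A)
    {z : ℂ} (hz : 0 < z.im) (x : K) : 0 ≤ (⟪x, sandwich F A z x⟫_ℂ).im := by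
  have := hA.inner_resolventAt_im_nonneg hz (F.adjoint x)
  rwa [ContinuousLinearMap.adjoint_inner_left] at this

end Resolvent

/-! ### Hilbert-Schmidt and compact operators. -/

section Compact

open InnerProductSpace

variable {H K : Type*} [NormedAddCommGroup H] [InnerProductSpace ℂ H]
  [NormedAddCommGroup K] [InnerProductSpace ℂ K]

theorem isCompactOperator_rankOne (x : K) (y : H) : IsCompactOperator (rankOne ℂ x y) := by
  rw [rankOne_def']
  exact (isCompactOperator_of_locallyCompactSpace_rng
    (ContinuousLinearMap.toSpanSingleton ℂ x : ℂ →L[ℂ] K)).comp_clm (innerSL ℂ y)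

theorem isCompactOperator_sum_rankOne {ι : Type*} (s : Finset ι) (x : ι → K) (y : ι → H) :
    IsCompactOperator (∑ i ∈ s, rankOne ℂ (x i) (y i) : H →L[ℂ] K) := by
  classical
  induction s using Finset.induction_on with
  | empty => exact isCompactOperator_zero
  | insert a s ha ih =>
    rw [Finset.sum_insert ha]
    exact (isCompactOperator_rankOne _ _).add ih

theorem norm_sum_inner_smul_le {ι : Type*} {b : ι → H} (hb : Orthonormal ℂ b) (v : ι → K)
    (s : Finset ι) (x : H) :
    ‖∑ i ∈ s, ⟪b i, x⟫_ℂ • v i‖ ≤ √(∑ i ∈ s, ‖v i‖ ^ 2) * ‖x‖ := by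
  calc ‖∑ i ∈ s, ⟪b i, x⟫_ℂ • v i‖ ≤ ∑ i ∈ s, ‖v i‖ * ‖⟪b i, x⟫_ℂ‖ :=
        (norm_sum_le _ _).trans (Finset.sum_le_sum fun i _ => by rw [norm_smul, mul_comm])
    _ ≤ √(∑ i ∈ s, ‖v i‖ ^ 2) * √(∑ i ∈ s, ‖⟪b i, x⟫_ℂ‖ ^ 2) :=
        Real.sum_mul_le_sqrt_mul_sqrt _ _ _
    _ ≤ _ := by
        gcongr
        rw [Real.sqrt_le_left (norm_nonneg x)]
        exact hb.sum_inner_products_le x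

/-- Truncating the basis expansion gives finite-rank operators; by Cauchy-Schwarz and Bessel the
error is at most the square root of the tail of `∑ ‖F (b i)‖ ^ 2`. -/
theorem IsHilbertSchmidt.isCompactOperator [CompleteSpace K] {F : H →L[ℂ] K}
    (hF : IsHilbertSchmidt F) : IsCompactOperator F := by
  classical
  obtain ⟨w, b, hs⟩ := hF
  refine (isClosed_setOfPred_isCompactOperator (M₁ := H) (M₂ := K)
    (σ₁₂ := RingHom.id ℂ)).closure_subset (Metric.mem_closure_iff.2 fun ε hε => ?_)
  obtain ⟨s, hsv⟩ := summable_iff_vanishing_norm.1 hs ((ε / 2) ^ 2) (by positivity)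
  refine ⟨∑ i ∈ s, rankOne ℂ (F (b i)) (b i), isCompactOperator_sum_rankOne _ _ _, ?_⟩
  rw [dist_eq_norm]
  refine lt_of_le_of_lt (ContinuousLinearMap.opNorm_le_bound _ (by positivity : 0 ≤ ε / 2)
    fun x => ?_) (half_lt_self hε)
  have h1 : HasSum (fun i => ⟪b i, x⟫_ℂ • F (b i)) (F x) := by
    have := (b.hasSum_repr x).mapL F
    simpa [HilbertBasis.repr_apply_apply] using this
  have h2 : Tendsto (fun t : Finset w => ‖∑ i ∈ t, ⟪b i, x⟫_ℂ • F (b i) -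
      (∑ i ∈ s, rankOne ℂ (F (b i)) (b i)) x‖) atTop
      (𝓝 ‖F x - (∑ i ∈ s, rankOne ℂ (F (b i)) (b i)) x‖) :=
    (Tendsto.sub_const h1 _).norm
  refine le_of_tendsto h2 (eventually_ge_atTop s |>.mono fun t ht => ?_)
  rw [sum_apply]
  simp only [rankOne_apply]
  rw [← Finset.sum_sdiff ht, add_sub_cancel_right]
  refine (norm_sum_inner_smul_le b.orthonormal _ _ x).trans ?_
  gcongr
  rw [Real.sqrt_le_left (by positivity)]
  have := hsv (t \ s) Finset.sdiff_disjoint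
  rw [Real.norm_eq_abs] at this
  exact (le_abs_self _).trans this.le

/-- A compact operator is almost compressed to a finite-dimensional subspace. -/
theorem _root_.IsCompactOperator.exists_finiteDimensional {T : K →L[ℂ] K}
    (hT : IsCompactOperator T) {δ : ℝ} (hδ : 0 < δ) :
    ∃ W : Submodule ℂ K, FiniteDimensional ℂ W ∧ ∀ (W' : Submodule ℂ K) [W'.HasOrthogonalProjection],
      W ≤ W' → ‖(1 - W'.starProjection) * T‖ ≤ δ := by
  have htb := (hT.isCompact_closure_image_closedBall 1).totallyBounded
  obtain ⟨t, ht, htc⟩ := Metric.totallyBounded_iff.1 htb δ hδ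
  -- The span of a finite `δ`-net of the image of the unit ball works. Every larger `W'` also fixes
  -- the net, so several such subspaces can later be joined.
  refine ⟨Submodule.span ℂ t, FiniteDimensional.span_of_finite ℂ ht, fun W' _ hW => ?_⟩
  refine ContinuousLinearMap.opNorm_le_of_unit_norm hδ.le fun x hx => ?_
  have hx' : T x ∈ closure (T '' Metric.closedBall 0 1) :=
    subset_closure ⟨x, by simp [hx], rfl⟩
  obtain ⟨y, hy, hxy⟩ := Set.mem_iUnion₂.1 (htc hx')
  have hyW : y ∈ W' := hW (Submodule.subset_span hy)
  have hy0 : (1 - W'.starProjection) y = 0 := by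
    rw [sub_apply, one_apply_eq_self, W'.starProjection_eq_self_iff.2 hyW, sub_self]
  calc ‖((1 - W'.starProjection) * T) x‖ = ‖(1 - W'.starProjection) (T x - y)‖ := by
        rw [map_sub, hy0, sub_zero]; rfl
    _ ≤ 1 * ‖T x - y‖ := by
        rw [← W'.starProjection_orthogonal']
        exact ContinuousLinearMap.le_of_opNorm_le _ (W'ᗮ.starProjection_norm_le) _
    _ ≤ δ := by rw [one_mul]; exact (mem_ball_iff_norm.1 hxy).le

end Compact

/-! ### Passing between operators and matrices of compressions. -/

section Compression

open InnerProductSpace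

variable {K : Type*} [NormedAddCommGroup K] [InnerProductSpace ℂ K]
variable {ι : Type*}

/-- The matrix of the compression of `A` to the span of the family `e`. -/
noncomputable def compression (e : ι → K) (A : K →L[ℂ] K) : Matrix ι ι ℂ :=
  Matrix.of fun i j => ⟪e i, A (e j)⟫_ℂ

variable [Fintype ι] in
/-- The operator on the span of `e` with the matrix `c`, extended by zero. -/
noncomputable def extension (e : ι → K) (c : Matrix ι ι ℂ) : K →L[ℂ] K :=
  ∑ i, ∑ j, c i j • rankOne ℂ (e i) (e j)

variable (e : ι → K)

theorem compression_apply (A : K →L[ℂ] K) (i j : ι) : compression e A i j = ⟪e i, A (e j)⟫_ℂ := rfl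

theorem compression_add (A B : K →L[ℂ] K) :
    compression e (A + B) = compression e A + compression e B := by
  ext i j; simp [compression_apply]

theorem compression_smul (c : ℂ) (A : K →L[ℂ] K) :
    compression e (c • A) = c • compression e A := by
  ext i j; simp [compression_apply]

theorem compression_sub (A B : K →L[ℂ] K) :
    compression e (A - B) = compression e A - compression e B := by
  ext i j; simp [compression_apply]

theorem compression_star [CompleteSpace K] (A : K →L[ℂ] K) :
    compression e (star A) = (compression e A).conjTranspose := by
  ext i j
  rw [Matrix.conjTranspose_apply, compression_apply, compression_apply,
    ContinuousLinearMap.star_eq_adjoint, ContinuousLinearMap.adjoint_inner_right]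
  exact (inner_conj_symm _ _).symm

variable {e} in
theorem compression_one [DecidableEq ι] (he : Orthonormal ℂ e) : compression e 1 = 1 := by
  ext i j
  rw [compression_apply, one_apply_eq_self, orthonormal_iff_ite.1 he, Matrix.one_apply]

variable [Fintype ι]

theorem extension_apply (c : Matrix ι ι ℂ) (x : K) :
    extension e c x = ∑ i, c.mulVec (fun j => ⟪e j, x⟫_ℂ) i • e i := by
  simp [extension, smul_smul, Matrix.mulVec, dotProduct, Finset.sum_smul]

theorem inner_apply_sum (A : K →L[ℂ] K) (v : ι → ℂ) :
    (fun i => ⟪e i, A (∑ j, v j • e j)⟫_ℂ) = (compression e A).mulVec v := by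
  ext i
  simp [Matrix.mulVec, dotProduct, compression_apply, mul_comm]

/-- For `c = 1` and orthonormal `e` the middle factor is the projection, and compression is
multiplicative across it. Operator identities become matrix identities in this way. -/
theorem compression_mul_extension_mul (A B : K →L[ℂ] K) (c : Matrix ι ι ℂ) :
    compression e (A * extension e c * B) = compression e A * c * compression e B := by
  ext i j
  rw [compression_apply, mul_apply_eq_comp, mul_apply_eq_comp, extension_apply,
    congrFun (inner_apply_sum e A _) i, Matrix.mulVec_mulVec]
  simp [Matrix.mulVec, dotProduct, Matrix.mul_apply (N := compression e B), compression_apply]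

theorem extension_mul_mul_extension (A : K →L[ℂ] K) (c d : Matrix ι ι ℂ) :
    extension e c * A * extension e d = extension e (c * compression e A * d) := by
  ext x
  rw [mul_apply_eq_comp, mul_apply_eq_comp, extension_apply, extension_apply, extension_apply,
    inner_apply_sum, Matrix.mulVec_mulVec, Matrix.mulVec_mulVec]

/-- The orthogonal projection onto a finite-dimensional subspace, in an orthonormal basis. -/
theorem exists_orthonormal_starProjection_eq (W : Submodule ℂ K) [FiniteDimensional ℂ W] :
    ∃ (n : ℕ) (e : Fin n → K), Orthonormal ℂ e ∧ W.starProjection = extension e 1 := by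
  let b := stdOrthonormalBasis ℂ W
  refine ⟨_, fun i => (b i : K), ?_, ?_⟩
  · exact b.orthonormal.comp_linearIsometry W.subtypeₗᵢ
  · ext x
    rw [extension_apply, Matrix.one_mulVec, Submodule.starProjection_apply,
      b.orthogonalProjectionOnto_apply_eq_sum x]
    simp

end Compression

/-! ### Meromorphic functions with values in algebras and matrices. -/

section Meromorphic

theorem _root_.MeromorphicAt.mul_normedAlgebra {A : Type*} [NormedRing A] [NormedAlgebra ℂ A]
    {f g : ℂ → A} {x : ℂ} (hf : MeromorphicAt f x) (hg : MeromorphicAt g x) :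
    MeromorphicAt (fun z => f z * g z) x := by
  obtain ⟨m, hm⟩ := hf
  obtain ⟨n, hn⟩ := hg
  refine ⟨m + n, (hm.mul hn).congr (.of_forall fun z => ?_)⟩
  simp [pow_add, smul_smul, mul_comm]

theorem _root_.MeromorphicAt.clm_apply_const {E E' : Type*} [NormedAddCommGroup E]
    [NormedSpace ℂ E] [NormedAddCommGroup E'] [NormedSpace ℂ E'] (L : E →L[ℂ] E')
    {f : ℂ → E} {x : ℂ} (hf : MeromorphicAt f x) : MeromorphicAt (fun z => L (f z)) x := by
  obtain ⟨m, hm⟩ := hf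
  refine ⟨m, ((L.analyticAt _).comp hm).congr (.of_forall fun z => ?_)⟩
  simp

theorem analyticAt_det {ι : Type*} [Fintype ι] [DecidableEq ι] {N : ℂ → Matrix ι ι ℂ} {x : ℂ}
    (hN : ∀ i j, AnalyticAt ℂ (fun z => N z i j) x) : AnalyticAt ℂ (fun z => (N z).det) x := by
  simp only [Matrix.det_apply']
  refine Finset.analyticAt_fun_sum _ fun σ _ => analyticAt_const.mul ?_
  exact Finset.analyticAt_fun_prod _ fun i _ => hN _ _

theorem meromorphicAt_matrix_inv {ι : Type*} [Fintype ι] [DecidableEq ι] {N : ℂ → Matrix ι ι ℂ}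
    {x : ℂ} (hN : ∀ i j, AnalyticAt ℂ (fun z => N z i j) x) (i j : ι) :
    MeromorphicAt (fun z => (N z)⁻¹ i j) x := by
  simp only [Matrix.inv_def, Matrix.smul_apply, Ring.inverse_eq_inv', smul_eq_mul,
    Matrix.adjugate_apply]
  refine (analyticAt_det hN).meromorphicAt.inv.mul (AnalyticAt.meromorphicAt ?_)
  refine analyticAt_det fun k l => ?_
  by_cases h : k = j
  · subst h; simpa using analyticAt_const
  · simpa [Matrix.updateRow_ne h] using hN k l

end Meromorphic

/-! ### Analytic Fredholm theory. -/

section Fredholm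

open InnerProductSpace

variable {K : Type*} [NormedAddCommGroup K] [InnerProductSpace ℂ K] [CompleteSpace K]

omit [CompleteSpace K] in
/-- Inversion of a finite-rank perturbation of the identity. -/
theorem mul_eq_one_of_matrix {ι : Type*} [Fintype ι] [DecidableEq ι] {e : ι → K}
    {M : K →L[ℂ] K} {c : Matrix ι ι ℂ} :
    ((1 + compression e M) * c = 1 → (1 + extension e 1 * M) * (1 - extension e c * M) = 1) ∧
    (c * (1 + compression e M) = 1 → (1 - extension e c * M) * (1 + extension e 1 * M) = 1) := by
  have hsub : ∀ a b : Matrix ι ι ℂ, extension e (a + b) = extension e a + extension e b := by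
    intro a b
    simp [extension, add_smul, Finset.sum_add_distrib]
  have h1 := extension_mul_mul_extension e M 1 c
  have h2 := extension_mul_mul_extension e M c 1
  constructor
  · intro h
    rw [Matrix.one_mul] at h1
    have h3 : extension e 1 = extension e c + extension e 1 * M * extension e c := by
      rw [h1, ← hsub, ← h]; congr 1; rw [add_mul, Matrix.one_mul]
    calc _ = 1 + (extension e 1 - (extension e c + extension e 1 * M * extension e c)) * M := by
          noncomm_ring
      _ = 1 := by rw [← h3]; simp
  · intro h
    rw [Matrix.mul_one] at h2
    have h3 : extension e 1 = extension e c + extension e c * M * extension e 1 := by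
      rw [h2, ← hsub, ← h]; congr 1; rw [mul_add, Matrix.mul_one]
    calc _ = 1 + (extension e 1 - (extension e c + extension e c * M * extension e 1)) * M := by
          noncomm_ring
      _ = 1 := by rw [← h3]; simp

theorem _root_.Ring.inverse_eq_of_mul_eq_one {R : Type*} [Ring R] {a b : R} (h : a * b = 1)
    (h' : b * a = 1) : Ring.inverse a = b :=
  Ring.inverse_unit (⟨a, b, h, h'⟩ : Rˣ)

/-- Analytic Fredholm theory for the resolvent of a compact operator. -/
theorem _root_.IsCompactOperator.meromorphicAt_inverse {T : K →L[ℂ] K} (hT : IsCompactOperator T)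
    (s₀ : ℂ) : MeromorphicAt (fun s : ℂ => Ring.inverse (1 + s • T)) s₀ ∧
      ∀ᶠ s in 𝓝[≠] s₀, IsUnit (1 + s • T) := by
  -- The disc about `0` contains both `s₀` and `0`; at `0` the determinant below equals `1`. The
  -- choice `δ = (2 * R)⁻¹` gives `‖s • E‖ ≤ 1/2` there.
  set R := ‖s₀‖ + 1 with hR
  have hRpos : 0 < R := by positivity
  obtain ⟨W, hW, hWT⟩ := hT.exists_finiteDimensional (δ := (2 * R)⁻¹) (by positivity)
  obtain ⟨n, e, he, hP⟩ := exists_orthonormal_starProjection_eq W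
  have hE := hWT W le_rfl
  rw [hP] at hE
  set P := extension e 1 with hPdef
  set E := (1 - P) * T with hEdef
  have hunit : ∀ s ∈ Metric.ball (0 : ℂ) R, IsUnit (1 + s • E) := by
    intro s hs
    rw [mem_ball_zero_iff] at hs
    have : ‖-(s • E)‖ < 1 := by
      rw [norm_neg, norm_smul]
      calc ‖s‖ * ‖E‖ ≤ R * (2 * R)⁻¹ := by gcongr
        _ < 1 := by field_simp; norm_num
    simpa using isUnit_one_sub_of_norm_lt_one this
  have hlin : ∀ s, AnalyticAt ℂ (fun s : ℂ => 1 + s • E) s := fun s =>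
    analyticAt_const.add (analyticAt_id.smul analyticAt_const)
  have hD : ∀ s ∈ Metric.ball (0 : ℂ) R, AnalyticAt ℂ (fun s : ℂ => Ring.inverse (1 + s • E)) s := by
    intro s hs
    obtain ⟨u, hu⟩ := hunit s hs
    have h1 := analyticAt_inverse (𝕜 := ℂ) u
    rw [hu] at h1
    exact h1.comp (f := fun s : ℂ => 1 + s • E) (hlin s)
  -- Chosen so that `1 + s T = (1 + P M(s)) (1 + s E)`: the second factor is invertible on the disc
  -- and the first is reduced to the matrix `N s`.
  set M : ℂ → K →L[ℂ] K := fun s => s • (T * Ring.inverse (1 + s • E)) with hM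
  have hMan : ∀ s ∈ Metric.ball (0 : ℂ) R, AnalyticAt ℂ M s := fun s hs =>
    analyticAt_id.smul (analyticAt_const.mul (hD s hs))
  set N : ℂ → Matrix (Fin n) (Fin n) ℂ := fun s => 1 + compression e (M s) with hN
  have hNan : ∀ s ∈ Metric.ball (0 : ℂ) R, ∀ i j, AnalyticAt ℂ (fun z => N z i j) s := by
    intro s hs i j
    let L : (K →L[ℂ] K) →L[ℂ] ℂ := (innerSL ℂ (e i)).comp (ContinuousLinearMap.apply ℂ K (e j))
    have h1 : AnalyticAt ℂ (fun z => (1 : Matrix (Fin n) (Fin n) ℂ) i j + L (M z)) s :=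
      analyticAt_const.add ((L.analyticAt _).comp (hMan s hs))
    exact h1
  have hfac : ∀ s ∈ Metric.ball (0 : ℂ) R, (1 + s • T) = (1 + P * M s) * (1 + s • E) := by
    intro s hs
    have h1 := Ring.inverse_mul_cancel _ (hunit s hs)
    have h2 : M s * (1 + s • E) = s • T := by
      simp only [hM]
      rw [smul_mul_assoc, mul_assoc, h1, mul_one]
    rw [add_mul, one_mul, mul_assoc, h2, add_assoc, mul_smul_comm, ← smul_add, hEdef]
    congr 2
    noncomm_ring
  have hs₀ : s₀ ∈ Metric.ball (0 : ℂ) R := by rw [mem_ball_zero_iff]; linarith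
  have hdet : ∀ᶠ s in 𝓝[≠] s₀, (N s).det ≠ 0 := by
    have hdan : AnalyticOnNhd ℂ (fun z => (N z).det) (Metric.ball 0 R) := fun s hs =>
      analyticAt_det (hNan s hs)
    rcases (hdan s₀ hs₀).eventually_eq_zero_or_eventually_ne_zero with h | h
    -- A determinant vanishing near `s₀` would vanish on the whole disc, contradicting `N 0 = 1`.
    · exfalso
      have := hdan.eqOn_zero_of_preconnected_of_eventuallyEq_zero
        (convex_ball (0 : ℂ) R).isPreconnected hs₀ h (Metric.mem_ball_self hRpos)
      have h0 : compression e (0 : K →L[ℂ] K) = 0 := by ext i j; simp [compression_apply]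
      simp [hN, hM, h0] at this
    · exact h
  have hball : ∀ᶠ s in 𝓝[≠] s₀, s ∈ Metric.ball (0 : ℂ) R :=
    nhdsWithin_le_nhds (Metric.isOpen_ball.mem_nhds hs₀)
  have hinv : ∀ᶠ s in 𝓝[≠] s₀, (1 + s • T) *
      (Ring.inverse (1 + s • E) * (1 - extension e (N s)⁻¹ * M s)) = 1 ∧
      (Ring.inverse (1 + s • E) * (1 - extension e (N s)⁻¹ * M s)) * (1 + s • T) = 1 := by
    filter_upwards [hdet, hball] with s hd hs
    have hu : IsUnit (N s).det := isUnit_iff_ne_zero.2 hd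
    have m1 := mul_eq_one_of_matrix.1 (Matrix.mul_nonsing_inv _ hu)
    have m2 := mul_eq_one_of_matrix.2 (Matrix.nonsing_inv_mul _ hu)
    have h1 := Ring.inverse_mul_cancel _ (hunit s hs)
    have h2 := Ring.mul_inverse_cancel _ (hunit s hs)
    rw [hfac s hs]
    constructor
    · rw [mul_assoc, ← mul_assoc _ (Ring.inverse _), h2, one_mul, m1]
    · rw [mul_assoc, ← mul_assoc _ _ (1 + s • E), m2, one_mul, h1]
  refine ⟨?_, hinv.mono fun s hs => ⟨⟨_, _, hs.1, hs.2⟩, rfl⟩⟩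
  have hmer : MeromorphicAt (fun s => Ring.inverse (1 + s • E) *
      (1 - extension e (N s)⁻¹ * M s)) s₀ := by
    refine (hD s₀ hs₀).meromorphicAt.mul_normedAlgebra ((MeromorphicAt.const _ _).sub
      (MeromorphicAt.mul_normedAlgebra ?_ (hMan s₀ hs₀).meromorphicAt))
    simp only [extension]
    refine MeromorphicAt.fun_sum fun i _ => MeromorphicAt.fun_sum fun j _ => ?_
    exact (meromorphicAt_matrix_inv (hNan s₀ hs₀) i j).smul (MeromorphicAt.const _ _)
  refine hmer.congr (hinv.mono fun s hs => ?_)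
  exact (Ring.inverse_eq_of_mul_eq_one hs.1 hs.2).symm

end Fredholm

/-! ### The vanishing residue for matrices. -/

section MatrixResidue

open Polynomial Matrix

variable {n : Type*} [Fintype n] [DecidableEq n]

theorem eval_det_one_add_X_smul_map (a : Matrix n n ℂ) (s : ℂ) :
    ((1 + (X : ℂ[X]) • a.map C).det).eval s = (1 + s • a).det := by
  rw [← coe_evalRingHom, RingHom.map_det]
  congr 1
  ext i j
  by_cases h : i = j <;> simp [h, mul_comm s]

/-- Jacobi's formula: the logarithmic derivative of `det (1 + s a)`. -/
theorem trace_mul_inv_one_add_smul (a : Matrix n n ℂ) {s : ℂ} (hs : IsUnit (1 + s • a)) :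
    (a * (1 + s • a)⁻¹).trace =
      (derivative (1 + (X : ℂ[X]) • a.map C).det).eval s /
        ((1 + (X : ℂ[X]) • a.map C).det).eval s := by
  have hdet : IsUnit (1 + s • a).det := (Matrix.isUnit_iff_isUnit_det _).1 hs
  set M := a * (1 + s • a)⁻¹ with hM
  have hMa : M * (1 + s • a) = a := by
    rw [hM, Matrix.mul_assoc, Matrix.nonsing_inv_mul _ hdet, Matrix.mul_one]
  -- Recentring at `s`: from `1 + (X + s) a = (1 + X M)(1 + s a)`, differentiation at `X = 0`
  -- produces the trace of `M`.
  have key : ((1 + (X : ℂ[X]) • a.map C).det).comp (X + C s) =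
      (1 + (X : ℂ[X]) • M.map C).det * C (1 + s • a).det := by
    rw [← coe_compRingHom_apply, RingHom.map_det, RingHom.map_det, ← Matrix.det_mul]
    congr 1
    have h1 : (C : ℂ →+* ℂ[X]).mapMatrix (1 + s • a) = 1 + C s • a.map C := by
      ext i j
      by_cases h : i = j <;> simp [h]
    have h2 : M.map C * (C : ℂ →+* ℂ[X]).mapMatrix (1 + s • a) = a.map C := by
      conv_rhs => rw [← hMa]
      exact (Matrix.map_mul (f := (C : ℂ →+* ℂ[X]))).symm
    rw [Matrix.add_mul, Matrix.one_mul, Matrix.smul_mul, h2, h1]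
    ext i j
    by_cases h : i = j <;> simp [h] <;> ring
  have hder := congrArg (fun p : ℂ[X] => (derivative p).eval 0) key
  simp only [derivative_comp, derivative_mul, derivative_C, mul_zero, add_zero, eval_mul,
    eval_C, derivative_add, derivative_X, eval_one, eval_comp, eval_add, eval_X,
    zero_add, derivative_det_one_add_X_smul] at hder
  rw [eval_det_one_add_X_smul_map, eq_div_iff hdet.ne_zero, ← hder]
  simp

/-- Each point inside the circle contributes `2πi` and each point outside contributes `0`. The count
need not be identified: only its reality is used later. -/
theorem exists_nat_circleIntegral_sum_inv (c : ℂ) {R : ℝ} (hR : 0 < R) (m : Multiset ℂ)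
    (hm : ∀ z ∈ m, z ∉ Metric.sphere c R) :
    CircleIntegrable (fun s => (m.map fun z => 1 / (s - z)).sum) c R ∧
      ∃ N : ℕ, (∮ s in C(c, R), (m.map fun z => 1 / (s - z)).sum) = 2 * Real.pi * Complex.I * N := by
  induction m using Multiset.induction_on with
  | empty => exact ⟨by simp, 0, by simp [circleIntegral]⟩
  | cons z m ih =>
    obtain ⟨hi, N, hN⟩ := ih fun w hw => hm w (Multiset.mem_cons_of_mem hw)
    have hz := hm z (Multiset.mem_cons_self z m)
    have hcont : ContinuousOn (fun s => 1 / (s - z)) (Metric.sphere c R) := by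
      refine continuousOn_const.div (continuousOn_id.sub continuousOn_const) fun s hs h => hz ?_
      rwa [← sub_eq_zero.1 h]
    have hi1 : CircleIntegrable (fun s => 1 / (s - z)) c R := hcont.circleIntegrable hR.le
    simp only [Multiset.map_cons, Multiset.sum_cons]
    refine ⟨hi1.add hi, ?_⟩
    rw [circleIntegral.integral_add hi1 hi, hN]
    by_cases hzb : z ∈ Metric.ball c R
    · refine ⟨N + 1, ?_⟩
      simp only [one_div, circleIntegral.integral_sub_inv_of_mem_ball hzb]
      push_cast; ring
    · refine ⟨N, ?_⟩
      have hzc : z ∉ Metric.closedBall c R := by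
        rw [Metric.mem_closedBall]
        rw [Metric.mem_ball] at hzb
        rw [Metric.mem_sphere] at hz
        exact fun h => hzb (lt_of_le_of_ne h hz)
      have hne : ∀ s ∈ Metric.closedBall c R, s - z ≠ 0 := fun s hs h =>
        hzc (by rwa [← sub_eq_zero.1 h])
      have h0 : (∮ s in C(c, R), 1 / (s - z)) = 0 := by
        refine Complex.circleIntegral_eq_zero_of_differentiable_on_off_countable hR.le
          Set.countable_empty (continuousOn_const.div (continuousOn_id.sub continuousOn_const) hne)
          fun s hs => ?_
        exact (differentiableAt_const _).div (differentiableAt_id.sub (differentiableAt_const _))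
          (hne s (Metric.ball_subset_closedBall hs.1))
      rw [h0, zero_add]

/-- The argument principle for `det (1 + s a)`. -/
theorem exists_nat_circleIntegral_trace (a : Matrix n n ℂ) (c : ℂ) {R : ℝ} (hR : 0 < R)
    (ha : ∀ s ∈ Metric.sphere c R, IsUnit (1 + s • a)) :
    CircleIntegrable (fun s => (a * (1 + s • a)⁻¹).trace) c R ∧
    ∃ N : ℕ, (∮ s in C(c, R), (a * (1 + s • a)⁻¹).trace) = 2 * Real.pi * Complex.I * N := by
  set d := (1 + (X : ℂ[X]) • a.map C).det with hd
  have hne : ∀ s ∈ Metric.sphere c R, d.eval s ≠ 0 := fun s hs => by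
    rw [hd, eval_det_one_add_X_smul_map]
    exact ((Matrix.isUnit_iff_isUnit_det _).1 (ha s hs)).ne_zero
  have heq : Set.EqOn (fun s => (a * (1 + s • a)⁻¹).trace)
      (fun s => (d.roots.map fun z => 1 / (s - z)).sum) (Metric.sphere c R) := fun s hs => by
    simp only
    rw [trace_mul_inv_one_add_smul a (ha s hs),
      (IsAlgClosed.splits d).eval_derivative_div_eval_of_ne_zero (hne s hs)]
  obtain ⟨h1, h2⟩ := exists_nat_circleIntegral_sum_inv c hR d.roots
    fun z hz hzs => hne z hzs (isRoot_of_mem_roots hz)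
  rw [circleIntegral.integral_congr hR.le heq]
  exact ⟨(circleIntegrable_congr (by rwa [abs_of_pos hR])).2 h1, h2⟩

/-- Conjugation maps a circle with real centre to itself and reverses its orientation, through `θ ↦
2π - θ`; hence the sign. -/
theorem circleIntegral_conj (f : ℂ → ℂ) (x R : ℝ) :
    (∮ s in C((x : ℂ), R), starRingEnd ℂ (f (starRingEnd ℂ s))) =
      - starRingEnd ℂ (∮ s in C((x : ℂ), R), f s) := by
  have hmap : ∀ θ : ℝ, starRingEnd ℂ (circleMap x R θ) = circleMap x R (2 * Real.pi - θ) := by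
    intro θ
    simp only [circleMap, map_add, map_mul, Complex.conj_ofReal, ← Complex.exp_conj, Complex.conj_I]
    congr 2
    push_cast
    rw [sub_mul, Complex.exp_sub, Complex.exp_two_pi_mul_I, mul_neg, Complex.exp_neg, one_div]
  have hder : ∀ θ : ℝ, deriv (circleMap x R) θ =
      - starRingEnd ℂ (deriv (circleMap x R) (2 * Real.pi - θ)) := by
    intro θ
    have h0 : starRingEnd ℂ (circleMap 0 R (2 * Real.pi - θ)) = circleMap 0 R θ := by
      simp only [circleMap, map_add, map_mul, Complex.conj_ofReal, ← Complex.exp_conj,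
        Complex.conj_I, map_zero]
      congr 2
      push_cast
      rw [mul_neg, Complex.exp_neg, sub_mul, Complex.exp_sub, Complex.exp_two_pi_mul_I, one_div, inv_inv]
    rw [deriv_circleMap, deriv_circleMap, map_mul, h0, Complex.conj_I]
    ring
  have h1 : (∮ s in C((x : ℂ), R), starRingEnd ℂ (f (starRingEnd ℂ s))) =
      ∫ θ in (0 : ℝ)..2 * Real.pi,
        (fun φ => - starRingEnd ℂ (deriv (circleMap x R) φ • f (circleMap x R φ)))
          (2 * Real.pi - θ) := by
    rw [circleIntegral]
    refine intervalIntegral.integral_congr fun θ _ => ?_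
    simp only [smul_eq_mul, map_mul]
    rw [hmap, hder θ]
    ring
  rw [h1, intervalIntegral.integral_comp_sub_left (fun φ => - starRingEnd ℂ
      (deriv (circleMap x R) φ • f (circleMap x R φ))), sub_self, sub_zero, intervalIntegral.integral_neg,
    circleIntegral, intervalIntegral.integral_of_le (by positivity),
    intervalIntegral.integral_of_le (by positivity), integral_conj]

/-- Here `x = U j V` with `U`, `V` the two inverses. Writing `t - tᴴ` as `(1 + s tᴴ j) t - tᴴ (1 + s
j t)` gives `V (t - tᴴ) U = t U - V tᴴ`, and cyclicity of the trace does the rest. -/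
theorem trace_mul_sub_conjTranspose {j t x : Matrix n n ℂ} {s : ℂ}
    (ha : IsUnit (1 + s • (j * t))) (hc : IsUnit (1 + s • (tᴴ * j)))
    (hx : (1 + s • (j * t)) * x * (1 + s • (tᴴ * j)) = j) :
    (x * (t - tᴴ)).trace =
      (j * t * (1 + s • (j * t))⁻¹).trace - (tᴴ * j * (1 + s • (tᴴ * j))⁻¹).trace := by
  have ha' := (Matrix.isUnit_iff_isUnit_det _).1 ha
  have hc' := (Matrix.isUnit_iff_isUnit_det _).1 hc
  set U := (1 + s • (j * t))⁻¹ with hU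
  set V := (1 + s • (tᴴ * j))⁻¹ with hV
  have hU1 : U * (1 + s • (j * t)) = 1 := Matrix.nonsing_inv_mul _ ha'
  have hV2 : (1 + s • (tᴴ * j)) * V = 1 := Matrix.mul_nonsing_inv _ hc'
  have hxe : x = U * j * V := by
    calc x = (U * (1 + s • (j * t))) * x * ((1 + s • (tᴴ * j)) * V) := by
          rw [hU1, hV2, Matrix.one_mul, Matrix.mul_one]
      _ = U * ((1 + s • (j * t)) * x * (1 + s • (tᴴ * j))) * V := by noncomm_ring
      _ = _ := by rw [hx]
  have hV1 : V * (1 + s • (tᴴ * j)) = 1 := Matrix.nonsing_inv_mul _ hc'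
  have hU2 : (1 + s • (j * t)) * U = 1 := Matrix.mul_nonsing_inv _ ha'
  have e2 : (x * (t - tᴴ)).trace = (j * (V * (t - tᴴ) * U)).trace := by
    rw [hxe, mul_assoc, mul_assoc, Matrix.trace_mul_comm]
    simp only [mul_assoc]
  have e3 : V * (t - tᴴ) * U = t * U - V * tᴴ := by
    calc V * (t - tᴴ) * U = V * ((1 + s • (tᴴ * j)) * t - tᴴ * (1 + s • (j * t))) * U := by
          congr 2
          simp only [mul_add, add_mul, one_mul, mul_one, smul_mul_assoc, mul_smul_comm, mul_assoc]
          abel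
      _ = (V * (1 + s • (tᴴ * j))) * t * U - V * tᴴ * ((1 + s • (j * t)) * U) := by noncomm_ring
      _ = _ := by rw [hV1, hU2, one_mul, mul_one]
  rw [e2, e3, mul_sub, Matrix.trace_sub, mul_assoc]
  congr 1
  rw [← mul_assoc, Matrix.trace_mul_comm, ← mul_assoc]

/-- In finite dimensions the residue at a real point is the difference of the multiplicities of
two complex conjugate zeros, and hence vanishes. -/
theorem circleIntegral_trace_mul_sub_conjTranspose {j t : Matrix n n ℂ} (hj : jᴴ = j) (c : ℝ) {R : ℝ}
    (hR : 0 < R) {x : ℂ → Matrix n n ℂ}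
    (hu : ∀ s ∈ Metric.sphere (c : ℂ) R, IsUnit (1 + s • (j * t)))
    (hx : ∀ s ∈ Metric.sphere (c : ℂ) R,
      (1 + s • (j * t)) * x s * (1 + s • (tᴴ * j)) = j) :
    (∮ s in C((c : ℂ), R), (x s * (t - tᴴ)).trace) = 0 := by
  have hstar : ∀ s : ℂ, 1 + s • (tᴴ * j) = (1 + (starRingEnd ℂ s) • (j * t))ᴴ := by
    intro s
    simp [Matrix.conjTranspose_add, Matrix.conjTranspose_smul, Matrix.conjTranspose_mul, hj]
  have hconj : ∀ s ∈ Metric.sphere (c : ℂ) R, starRingEnd ℂ s ∈ Metric.sphere (c : ℂ) R := by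
    intro s hs
    rw [mem_sphere_iff_norm] at hs ⊢
    rw [← hs, ← RCLike.norm_conj (s - c), map_sub, Complex.conj_ofReal]
  have hu' : ∀ s ∈ Metric.sphere (c : ℂ) R, IsUnit (1 + s • (tᴴ * j)) := fun s hs => by
    rw [hstar]
    exact (hu _ (hconj s hs)).star
  have h1 : Set.EqOn (fun s => (x s * (t - tᴴ)).trace)
      (fun s => (j * t * (1 + s • (j * t))⁻¹).trace - (tᴴ * j * (1 + s • (tᴴ * j))⁻¹).trace)
      (Metric.sphere (c : ℂ) R) := fun s hs =>
    trace_mul_sub_conjTranspose (hu s hs) (hu' s hs) (hx s hs)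
  obtain ⟨i1, N, hN⟩ := exists_nat_circleIntegral_trace (j * t) c hR hu
  obtain ⟨i2, -⟩ := exists_nat_circleIntegral_trace (tᴴ * j) c hR hu'
  have h2 : ∀ s : ℂ, (tᴴ * j * (1 + s • (tᴴ * j))⁻¹).trace = starRingEnd ℂ
      ((fun s => (j * t * (1 + s • (j * t))⁻¹).trace) (starRingEnd ℂ s)) := by
    intro s
    simp only
    rw [hstar, ← Matrix.conjTranspose_nonsing_inv, Matrix.trace_mul_comm,
      show tᴴ * j = (j * t)ᴴ by rw [Matrix.conjTranspose_mul, hj], ← Matrix.conjTranspose_mul,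
      Matrix.trace_conjTranspose]
    rfl
  rw [circleIntegral.integral_congr hR.le h1, circleIntegral.integral_sub i1 i2]
  -- The second integral is `-conj (2πi N) = 2πi N`, so it cancels the first.
  rw [circleIntegral.integral_congr hR.le fun s _ => h2 s,
    circleIntegral_conj (fun s => (j * t * (1 + s • (j * t))⁻¹).trace), hN]
  simp [show starRingEnd ℂ (2 : ℂ) = 2 from Complex.conj_ofNat 2]

end MatrixResidue

/-! ### The functional `X ↦ Tr (S X S)` and cyclicity. -/

section VectorTrace

open InnerProductSpace

variable {K : Type*} [NormedAddCommGroup K] [InnerProductSpace ℂ K]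
variable {ι : Type*}

theorem norm_inner_apply_self_le (X : K →L[ℂ] K) (x : K) : ‖⟪x, X x⟫_ℂ‖ ≤ ‖X‖ * ‖x‖ ^ 2 := by
  calc ‖⟪x, X x⟫_ℂ‖ ≤ ‖x‖ * ‖X x‖ := norm_inner_le_norm _ _
    _ ≤ ‖x‖ * (‖X‖ * ‖x‖) := by gcongr; exact X.le_opNorm x
    _ = _ := by ring

theorem summable_inner_apply_self {v : ι → K} (hv : Summable fun i => ‖v i‖ ^ 2)
    (X : K →L[ℂ] K) : Summable fun i => ⟪v i, X (v i)⟫_ℂ :=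
  (hv.mul_left ‖X‖).of_norm_bounded fun i => norm_inner_apply_self_le X (v i)

/-- The functional `X ↦ ∑ᵢ ⟨vᵢ, X vᵢ⟩`. -/
noncomputable def vectorTrace (v : ι → K) (hv : Summable fun i => ‖v i‖ ^ 2) :
    (K →L[ℂ] K) →L[ℂ] ℂ :=
  LinearMap.mkContinuous
    { toFun := fun X => ∑' i, ⟪v i, X (v i)⟫_ℂ
      map_add' := fun X Y => by
        simp only [add_apply, inner_add_right]
        exact (summable_inner_apply_self hv X).tsum_add (summable_inner_apply_self hv Y)
      map_smul' := fun c X => by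
        simp only [smul_apply, inner_smul_right, RingHom.id_apply, smul_eq_mul, tsum_mul_left] }
    (∑' i, ‖v i‖ ^ 2) fun X => by
      rw [mul_comm]
      exact tsum_of_norm_bounded (hv.hasSum.mul_left ‖X‖) fun i => norm_inner_apply_self_le X (v i)

theorem vectorTrace_apply (v : ι → K) (hv : Summable fun i => ‖v i‖ ^ 2) (X : K →L[ℂ] K) :
    vectorTrace v hv X = ∑' i, ⟪v i, X (v i)⟫_ℂ := rfl

theorem exists_norm_vectorTrace_sub_le (v : ι → K) (hv : Summable fun i => ‖v i‖ ^ 2) {δ : ℝ}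
    (hδ : 0 < δ) : ∃ W : Submodule ℂ K, FiniteDimensional ℂ W ∧
      ∀ (W' : Submodule ℂ K) [W'.HasOrthogonalProjection], W ≤ W' → ∀ X : K →L[ℂ] K,
        ‖vectorTrace v hv X - vectorTrace v hv (W'.starProjection * X * W'.starProjection)‖
          ≤ δ * ‖X‖ := by
  classical
  -- Vectors with index in `s` are fixed by the projection and contribute no error; each remaining
  -- one costs at most `2 ‖X‖ ‖v i‖ ^ 2`, so a tail below `δ / 2` suffices.
  obtain ⟨s, hs⟩ := (((tendsto_order.1 hv.hasSum).1 (∑' i, ‖v i‖ ^ 2 - δ / 2) (by linarith))).exists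
  refine ⟨Submodule.span ℂ (v '' s), FiniteDimensional.span_of_finite ℂ (s.finite_toSet.image v),
    fun W' _ hW X => ?_⟩
  set P := W'.starProjection with hP
  have hPs : ∀ i ∈ s, P (v i) = v i := fun i hi =>
    W'.starProjection_eq_self_iff.2 (hW (Submodule.subset_span ⟨i, hi, rfl⟩))
  have hg : HasSum (fun i => 2 * ‖X‖ * (‖v i‖ ^ 2 - if i ∈ s then ‖v i‖ ^ 2 else 0))
      (2 * ‖X‖ * (∑' i, ‖v i‖ ^ 2 - ∑ i ∈ s, ‖v i‖ ^ 2)) := by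
    refine (hv.hasSum.sub ?_).mul_left _
    rw [← Finset.sum_congr rfl fun i hi => if_pos (c := i ∈ s) (e := (0 : ℝ)) hi]
    exact hasSum_sum_of_ne_finset_zero fun i hi => if_neg hi
  rw [vectorTrace_apply, vectorTrace_apply,
    ← (summable_inner_apply_self hv X).tsum_sub (summable_inner_apply_self hv _)]
  refine (tsum_of_norm_bounded hg fun i => ?_).trans ?_
  · have hPi : ⟪v i, (P * X * P) (v i)⟫_ℂ = ⟪P (v i), X (P (v i))⟫_ℂ :=
      (W'.inner_starProjection_left_eq_right (v i) (X (P (v i)))).symm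
    rw [hPi]
    by_cases hi : i ∈ s
    · simp [hPs i hi, hi]
    · have hn : ‖P (v i)‖ ≤ ‖v i‖ := W'.norm_starProjection_apply_le (v i)
      rw [if_neg hi, sub_zero, two_mul, add_mul]
      refine (norm_sub_le _ _).trans (add_le_add (norm_inner_apply_self_le X (v i))
        ((norm_inner_apply_self_le X _).trans ?_))
      gcongr
  · have := norm_nonneg X
    nlinarith

/-- By Parseval a rank-one operator is sent to a matrix entry of `S * S`. Since `S * S` will be a
multiple of `T - T*`, this produces the factor `t - tᴴ` of the matrix formula. -/
theorem vectorTrace_extension [CompleteSpace K] (b : HilbertBasis ι ℂ K) {S : K →L[ℂ] K}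
    (hS : IsSelfAdjoint S) (hv : Summable fun i => ‖S (b i)‖ ^ 2) {n : Type*} [Fintype n]
    (e : n → K) (c : Matrix n n ℂ) :
    vectorTrace (fun i => S (b i)) hv (extension e c) = (c * compression e (S * S)).trace := by
  have hSs : ∀ x y : K, ⟪S x, y⟫_ℂ = ⟪x, S y⟫_ℂ := hS.isSymmetric
  have h1 : ∀ k l, vectorTrace (fun i => S (b i)) hv (rankOne ℂ (e k) (e l)) =
      compression e (S * S) l k := by
    intro k l
    rw [vectorTrace_apply, compression_apply, mul_apply_eq_comp, ← hSs, ← b.tsum_inner_mul_inner]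
    refine tsum_congr fun i => ?_
    rw [rankOne_apply, inner_smul_right, hSs, ← hSs]
  simp only [extension, map_sum, map_smul, h1, Matrix.trace, Matrix.diag, Matrix.mul_apply, smul_eq_mul]

/-- The Hilbert-Schmidt inner product is preserved by taking adjoints. -/
theorem tsum_inner_eq_tsum_inner_adjoint [CompleteSpace K] (b : HilbertBasis ι ℂ K)
    {X Y : K →L[ℂ] K} (hX : Summable fun i => ‖X.adjoint (b i)‖ ^ 2)
    (hY : Summable fun i => ‖Y.adjoint (b i)‖ ^ 2) :
    ∑' i, ⟪Y (b i), X (b i)⟫_ℂ = ∑' j, ⟪X.adjoint (b j), Y.adjoint (b j)⟫_ℂ := by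
  have hsq : ∀ Z : K →L[ℂ] K, (Summable fun i => ‖Z.adjoint (b i)‖ ^ 2) →
      Summable fun p : ι × ι => ‖⟪b p.2, Z.adjoint (b p.1)⟫_ℂ‖ ^ 2 := by
    intro Z hZ
    have hp : ∀ x : K, HasSum (fun i => ‖⟪b i, x⟫_ℂ‖ ^ 2) (‖x‖ ^ 2) := by
      intro x
      have h := b.hasSum_inner_mul_inner x x
      have h2 : ∀ i, ⟪x, b i⟫_ℂ * ⟪b i, x⟫_ℂ = ((‖⟪b i, x⟫_ℂ‖ ^ 2 : ℝ) : ℂ) := fun i => by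
        rw [← inner_conj_symm x, Complex.conj_mul', Complex.ofReal_pow]
      have h3 : ⟪x, x⟫_ℂ = ((‖x‖ ^ 2 : ℝ) : ℂ) := by
        rw [inner_self_eq_norm_sq_to_K, Complex.ofReal_pow]; rfl
      simp only [h2, h3] at h
      exact Complex.hasSum_ofReal.1 h
    refine (summable_prod_of_nonneg fun p => sq_nonneg _).2
      ⟨fun j => (hp (Z.adjoint (b j))).summable, ?_⟩
    exact hZ.congr fun j => ((hp (Z.adjoint (b j))).tsum_eq).symm
  -- Parseval makes both matrices square summable, so the products are absolutely summable and the
  -- double series may be interchanged.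
  have hsum : Summable fun p : ι × ι =>
      ⟪X.adjoint (b p.1), b p.2⟫_ℂ * ⟪b p.2, Y.adjoint (b p.1)⟫_ℂ := by
    refine ((hsq X hX).add (hsq Y hY)).of_norm_bounded fun p => ?_
    rw [norm_mul, ← norm_inner_symm]
    nlinarith [sq_nonneg (‖⟪b p.2, X.adjoint (b p.1)⟫_ℂ‖ - ‖⟪b p.2, Y.adjoint (b p.1)⟫_ℂ‖),
      sq_nonneg ‖⟪b p.2, X.adjoint (b p.1)⟫_ℂ‖, sq_nonneg ‖⟪b p.2, Y.adjoint (b p.1)⟫_ℂ‖]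
  calc ∑' i, ⟪Y (b i), X (b i)⟫_ℂ
      = ∑' i, ∑' j, ⟪X.adjoint (b j), b i⟫_ℂ * ⟪b i, Y.adjoint (b j)⟫_ℂ := by
        refine tsum_congr fun i => ?_
        rw [← b.tsum_inner_mul_inner]
        refine tsum_congr fun j => ?_
        rw [ContinuousLinearMap.adjoint_inner_left, ContinuousLinearMap.adjoint_inner_right, mul_comm]
    _ = ∑' j, ∑' i, ⟪X.adjoint (b j), b i⟫_ℂ * ⟪b i, Y.adjoint (b j)⟫_ℂ :=
        (Summable.tsum_comm (f := fun j i =>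
          ⟪X.adjoint (b j), b i⟫_ℂ * ⟪b i, Y.adjoint (b j)⟫_ℂ) hsum)
    _ = _ := tsum_congr fun j => b.tsum_inner_mul_inner _ _

/-- Cyclicity of the trace, `Tr (L* S S L J) = Tr (S L J L* S)`. -/
theorem tsum_inner_conj_eq_vectorTrace [CompleteSpace K] (b : HilbertBasis ι ℂ K) {S : K →L[ℂ] K}
    (hS : IsSelfAdjoint S) (hv : Summable fun i => ‖S (b i)‖ ^ 2) (L J : K →L[ℂ] K)
    (hJ : IsSelfAdjoint J) :
    ∑' i, ⟪b i, (star L * (S * S) * L * J) (b i)⟫_ℂ =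
      vectorTrace (fun i => S (b i)) hv (L * J * star L) := by
  have hb : ∀ Z : K →L[ℂ] K, Summable fun i => ‖Z (S (b i))‖ ^ 2 := fun Z => by
    refine (hv.mul_left (‖Z‖ ^ 2)).of_nonneg_of_le (fun i => by positivity) fun i => ?_
    rw [← mul_pow]
    gcongr
    exact Z.le_opNorm _
  have hSs : ∀ x y : K, ⟪S x, y⟫_ℂ = ⟪x, S y⟫_ℂ := hS.isSymmetric
  have hJs : ∀ x y : K, ⟪J x, y⟫_ℂ = ⟪x, J y⟫_ℂ := hJ.isSymmetric
  have hX : ∀ x, (S * L * J).adjoint x = (J * star L) (S x) := fun x => by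
    rw [← ContinuousLinearMap.star_eq_adjoint, star_mul, star_mul, hS.star_eq, hJ.star_eq]
    rfl
  have hY : ∀ x, (S * L).adjoint x = (star L) (S x) := fun x => by
    rw [← ContinuousLinearMap.star_eq_adjoint, star_mul, hS.star_eq]
    rfl
  have key := tsum_inner_eq_tsum_inner_adjoint b (X := S * L * J) (Y := S * L)
    (by simpa only [hX] using hb _) (by simpa only [hY] using hb _)
  rw [vectorTrace_apply]
  refine Eq.trans ?_ (key.trans ?_)
  · refine tsum_congr fun i => ?_
    simp only [mul_apply_eq_comp]
    rw [hSs, ContinuousLinearMap.star_eq_adjoint, ContinuousLinearMap.adjoint_inner_right]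
  · refine tsum_congr fun i => ?_
    rw [hX, hY]
    simp only [mul_apply_eq_comp]
    rw [hJs, ContinuousLinearMap.star_eq_adjoint, ContinuousLinearMap.adjoint_inner_left]

end VectorTrace

/-! ### From matrices to compact operators. -/

section Residue

variable {K : Type*} [NormedAddCommGroup K] [InnerProductSpace ℂ K] [CompleteSpace K]

/-- The operator `(1 + s J T)⁻¹ J (1 + s T* J)⁻¹`. -/
noncomputable def resolventProduct (J T : K →L[ℂ] K) (s : ℂ) : K →L[ℂ] K :=
  Ring.inverse (1 + s • (J * T)) * J * Ring.inverse (1 + s • (star T * J))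

/-- On a circle symmetric about the real axis, invertibility of one factor therefore implies that of
the other. -/
theorem star_one_add_smul {J : K →L[ℂ] K} (hJ : IsSelfAdjoint J) (T : K →L[ℂ] K) (s : ℂ) :
    1 + s • (star T * J) = star (1 + starRingEnd ℂ s • (J * T)) := by
  rw [star_add, star_one, star_smul, star_mul, hJ.star_eq, starRingEnd_apply, star_star]

theorem conj_mem_sphere {c : ℝ} {R : ℝ} {s : ℂ} (hs : s ∈ Metric.sphere (c : ℂ) R) :
    starRingEnd ℂ s ∈ Metric.sphere (c : ℂ) R := by
  rw [mem_sphere_iff_norm] at hs ⊢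
  rw [← hs, ← RCLike.norm_conj (s - c), map_sub, Complex.conj_ofReal]

theorem continuousAt_resolventProduct {J : K →L[ℂ] K} {T : K →L[ℂ] K} {s : ℂ}
    (h1 : IsUnit (1 + s • (J * T))) (h2 : IsUnit (1 + s • (star T * J))) :
    ContinuousAt (fun p : (K →L[ℂ] K) × ℂ => resolventProduct J p.1 p.2) (T, s) := by
  have c1 : Continuous fun p : (K →L[ℂ] K) × ℂ => 1 + p.2 • (J * p.1) := by fun_prop
  have c2 : Continuous fun p : (K →L[ℂ] K) × ℂ => 1 + p.2 • (star p.1 * J) := by fun_prop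
  obtain ⟨u, hu⟩ := h1
  obtain ⟨v, hv⟩ := h2
  have i1 := NormedRing.inverse_continuousAt u
  have i2 := NormedRing.inverse_continuousAt v
  rw [hu] at i1
  rw [hv] at i2
  exact ((i1.comp (f := fun p : (K →L[ℂ] K) × ℂ => 1 + p.2 • (J * p.1)) (x := (T, s))
    c1.continuousAt).mul continuousAt_const).mul
    (i2.comp (f := fun p : (K →L[ℂ] K) × ℂ => 1 + p.2 • (star p.1 * J)) (x := (T, s))
    c2.continuousAt)

theorem norm_sub_compress_le {W : Submodule ℂ K} [W.HasOrthogonalProjection] {T : K →L[ℂ] K}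
    {δ : ℝ} (h1 : ‖(1 - W.starProjection) * T‖ ≤ δ) (h2 : ‖(1 - W.starProjection) * star T‖ ≤ δ) :
    ‖W.starProjection * T * W.starProjection - T‖ ≤ 2 * δ := by
  set P := W.starProjection
  have hP : star P = P := isSelfAdjoint_starProjection W
  have h3 : ‖T * (1 - P)‖ ≤ δ := by
    rw [← norm_star]
    simpa [star_mul, hP] using h2
  have h4 : P * T * P - T = -((1 - P) * T + P * (T * (1 - P))) := by noncomm_ring
  rw [h4, norm_neg]
  have h5 : ‖P * (T * (1 - P))‖ ≤ 1 * δ :=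
    (norm_mul_le _ _).trans (mul_le_mul W.starProjection_norm_le h3 (norm_nonneg _) zero_le_one)
  linarith [norm_add_le ((1 - P) * T) (P * (T * (1 - P)))]

/-- The residue vanishes for the compression of `T` to a finite-dimensional subspace. -/
theorem circleIntegral_vectorTrace_compress_eq_zero {ι : Type*} (b : HilbertBasis ι ℂ K)
    {S J T : K →L[ℂ] K} (hS : IsSelfAdjoint S) (hv : Summable fun i => ‖S (b i)‖ ^ 2)
    (hJ : IsSelfAdjoint J) {a : ℂ} (hST : S * S = a • (T - star T)) (W : Submodule ℂ K)
    [FiniteDimensional ℂ W] (c : ℝ) {R : ℝ} (hR : 0 < R)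
    (hu : ∀ s ∈ Metric.sphere (c : ℂ) R,
      IsUnit (1 + s • (J * (W.starProjection * T * W.starProjection)))) :
    (∮ s in C((c : ℂ), R), vectorTrace (fun i => S (b i)) hv (W.starProjection *
      resolventProduct J (W.starProjection * T * W.starProjection) s * W.starProjection)) = 0 := by
  obtain ⟨n, e, he, hP⟩ := exists_orthonormal_starProjection_eq W
  have hPs : star W.starProjection = W.starProjection := isSelfAdjoint_starProjection W
  rw [hP] at hPs hu ⊢
  set P := extension e 1 with hPdef
  set t := compression e T with ht
  set j := compression e J with hj
  have hjs : j.conjTranspose = j := by rw [hj, ← compression_star, hJ.star_eq]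
  have hm : ∀ A B, compression e (A * P * B) = compression e A * compression e B := fun A B => by
    rw [hPdef, compression_mul_extension_mul, mul_one]
  have hc1 := compression_one he
  have hu' : ∀ s ∈ Metric.sphere (c : ℂ) R, IsUnit (1 + s • (star (P * T * P) * J)) := fun s hs => by
    rw [star_one_add_smul hJ]
    exact (hu _ (conj_mem_sphere hs)).star
  set x : ℂ → Matrix (Fin n) (Fin n) ℂ := fun s => compression e (resolventProduct J (P * T * P) s)
  have hint : ∀ s, vectorTrace (fun i => S (b i)) hv (P * resolventProduct J (P * T * P) s * P) =
      a * (x s * (t - t.conjTranspose)).trace := by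
    intro s
    rw [hPdef, extension_mul_mul_extension, one_mul, mul_one, vectorTrace_extension b hS hv, hST,
      compression_smul, compression_sub, compression_star, Matrix.mul_smul, Matrix.trace_smul,
      smul_eq_mul]
  simp only [hint]
  rw [circleIntegral.integral_const_mul,
    circleIntegral_trace_mul_sub_conjTranspose hjs c hR (fun s hs => ?_) (fun s hs => ?_), mul_zero]
  · have h1 := Ring.mul_inverse_cancel _ (hu s hs)
    set U := Ring.inverse (1 + s • (J * (P * T * P)))
    -- The projection is bracketed between `J` and `T`, so that compressing the equation yields `(1
    -- + s j t)` times a matrix equal to `1`. Below, the equation for `X` is expanded in the same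
    -- way.
    have h2 : U + s • (J * P * (T * P * U)) = 1 := by
      rw [← h1, add_mul, one_mul, smul_mul_assoc]
      simp only [mul_assoc]
    have h3 := congrArg (compression e) h2
    rw [compression_add, compression_smul, hm, hm, hc1] at h3
    have h4 : (1 + s • (j * t)) * compression e U = 1 := by
      rw [add_mul, one_mul, Matrix.smul_mul, Matrix.mul_assoc, ht, hj, h3]
    exact (Matrix.isUnit_iff_isUnit_det _).2 (Matrix.isUnit_det_of_right_inverse h4)
  · have h1 := Ring.mul_inverse_cancel _ (hu s hs)
    have h2 := Ring.inverse_mul_cancel _ (hu' s hs)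
    have h3 : (1 + s • (J * (P * T * P))) * resolventProduct J (P * T * P) s *
        (1 + s • (star (P * T * P) * J)) = J := by
      rw [resolventProduct, mul_assoc, mul_assoc _ _ (1 + s • (star (P * T * P) * J)), h2, mul_one,
        ← mul_assoc, h1, one_mul]
    have hst : star (P * T * P) = P * star T * P := by
      rw [star_mul, star_mul, hPs, mul_assoc]
    set X := resolventProduct J (P * T * P) s
    rw [hst] at h3
    have h4 : (X + s • (J * P * (T * P * X))) +
        s • ((X + s • (J * P * (T * P * X))) * P * (star T * P * J)) = J := by
      refine Eq.trans ?_ h3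
      simp only [add_mul, mul_add, one_mul, mul_one, smul_mul_assoc, mul_smul_comm, mul_assoc]
    have h5 := congrArg (compression e) h4
    simp only [compression_add, compression_smul, hm, compression_star] at h5
    refine Eq.trans ?_ h5
    simp only [add_mul, mul_add, one_mul, mul_one, Matrix.smul_mul, Matrix.mul_smul,
      Matrix.mul_assoc, smul_add, add_assoc]
    rfl

theorem continuousOn_resolventProduct {J T : K →L[ℂ] K} {U : Set ℂ}
    (hu : ∀ s ∈ U, IsUnit (1 + s • (J * T))) (hu' : ∀ s ∈ U, IsUnit (1 + s • (star T * J))) :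
    ContinuousOn (resolventProduct J T) U := fun s hs =>
  ((continuousAt_resolventProduct (hu s hs) (hu' s hs)).comp
    (f := fun s : ℂ => (T, s)) (by fun_prop)).continuousWithinAt

/-- The integral vanishes for every compression of `T` whose factor stays invertible on the circle.
Compactness of `T` and `T*` gives compressions close to `T` in norm, and the integrands are then
uniformly close. -/
theorem circleIntegral_vectorTrace_eq_zero {ι : Type*} (b : HilbertBasis ι ℂ K)
    {S J T : K →L[ℂ] K} (hS : IsSelfAdjoint S) (hv : Summable fun i => ‖S (b i)‖ ^ 2)
    (hJ : IsSelfAdjoint J) {a : ℂ} (hST : S * S = a • (T - star T))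
    (hT : IsCompactOperator T) (hT' : IsCompactOperator (star T : K →L[ℂ] K)) (c : ℝ) {R : ℝ} (hR : 0 < R)
    (hu : ∀ s ∈ Metric.sphere (c : ℂ) R, IsUnit (1 + s • (J * T))) :
    (∮ s in C((c : ℂ), R), vectorTrace (fun i => S (b i)) hv (resolventProduct J T s)) = 0 := by
  set φ := vectorTrace (fun i => S (b i)) hv with hφ
  have hu' : ∀ s ∈ Metric.sphere (c : ℂ) R, IsUnit (1 + s • (star T * J)) := fun s hs => by
    rw [star_one_add_smul hJ]
    exact (hu _ (conj_mem_sphere hs)).star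
  have hcompact := isCompact_sphere (c : ℂ) R
  have hcont := continuousOn_resolventProduct hu hu'
  obtain ⟨M, hM⟩ := hcompact.exists_bound_of_continuousOn hcont
  have hM0 : 0 ≤ M := by
    have : (c + R : ℂ) ∈ Metric.sphere (c : ℂ) R := by simp [abs_of_pos hR]
    exact (norm_nonneg _).trans (hM _ this)
  have key : ∀ κ > 0, ‖∮ s in C((c : ℂ), R), φ (resolventProduct J T s)‖ ≤
      2 * Real.pi * R * (κ * M + ‖φ‖ * κ) := by
    intro κ hκ
    have hev : ∀ᶠ T' in 𝓝 T, ∀ s ∈ Metric.sphere (c : ℂ) R, IsUnit (1 + s • (J * T')) ∧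
        ‖resolventProduct J T s - resolventProduct J T' s‖ ≤ κ := by
      -- Joint continuity in the operator and in `s`, with compactness of the circle, gives one
      -- neighbourhood of `T` valid for all `s`.
      refine hcompact.eventually_forall_of_forall_eventually fun s hs => ?_
      have c1 : Continuous fun p : (K →L[ℂ] K) × ℂ => 1 + p.2 • (J * p.1) := by fun_prop
      have e1 : ∀ᶠ p : (K →L[ℂ] K) × ℂ in 𝓝 (T, s), IsUnit (1 + p.2 • (J * p.1)) :=
        (Units.isOpen.preimage c1).mem_nhds (hu s hs)
      have e2 : Tendsto (fun p : (K →L[ℂ] K) × ℂ => ‖resolventProduct J T p.2 -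
          resolventProduct J p.1 p.2‖) (𝓝 (T, s)) (𝓝 0) := by
        have h1 := continuousAt_resolventProduct (hu s hs) (hu' s hs)
        have h2 : ContinuousAt (fun p : (K →L[ℂ] K) × ℂ => resolventProduct J T p.2) (T, s) :=
          h1.comp (f := fun p : (K →L[ℂ] K) × ℂ => (T, p.2)) (x := (T, s)) (by fun_prop)
        simpa using (h2.sub h1).norm.tendsto
      filter_upwards [e1, (tendsto_order.1 e2).2 κ hκ] with p h1 h2
      exact ⟨h1, h2.le⟩
    obtain ⟨δ, hδ, hδT⟩ := Metric.eventually_nhds_iff.1 hev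
    obtain ⟨W₁, f₁, h₁⟩ := hT.exists_finiteDimensional (δ := δ / 4) (by positivity)
    obtain ⟨W₂, f₂, h₂⟩ := hT'.exists_finiteDimensional (δ := δ / 4) (by positivity)
    obtain ⟨W₃, f₃, h₃⟩ := exists_norm_vectorTrace_sub_le (fun i => S (b i)) hv hκ
    -- One subspace serves for `T`, for `T*` and for the functional; the compression is within `2 *
    -- (δ / 4) < δ` of `T`.
    set W := W₁ ⊔ W₂ ⊔ W₃ with hW
    have hd := norm_sub_compress_le (h₁ W (le_sup_left.trans le_sup_left))
      (h₂ W (le_sup_right.trans le_sup_left))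
    have h₃' := h₃ W le_sup_right
    have hz := hδT (y := W.starProjection * T * W.starProjection)
      (by rw [dist_eq_norm]; linarith)
    have h0 := circleIntegral_vectorTrace_compress_eq_zero b hS hv hJ hST W c hR
      fun s hs => (hz s hs).1
    rw [← hφ] at h0 h₃'
    have hu2 : ∀ s ∈ Metric.sphere (c : ℂ) R, IsUnit (1 + s •
        (star (W.starProjection * T * W.starProjection) * J)) := fun s hs => by
      rw [star_one_add_smul hJ]
      exact ((hz _ (conj_mem_sphere hs)).1).star
    have i1 : CircleIntegrable (fun s => φ (resolventProduct J T s)) c R :=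
      (φ.continuous.comp_continuousOn hcont).circleIntegrable hR.le
    have i2 : CircleIntegrable (fun s => φ (W.starProjection *
        resolventProduct J (W.starProjection * T * W.starProjection) s * W.starProjection)) c R :=
      (φ.continuous.comp_continuousOn ((continuousOn_const.mul (continuousOn_resolventProduct
        (fun s hs => (hz s hs).1) hu2)).mul continuousOn_const)).circleIntegrable hR.le
    rw [← sub_zero (∮ s in C((c : ℂ), R), φ (resolventProduct J T s)), ← h0,
      ← circleIntegral.integral_sub i1 i2]
    refine circleIntegral.norm_integral_le_of_norm_le_const hR.le fun s hs => ?_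
    set P := W.starProjection
    set X := resolventProduct J T s
    set X' := resolventProduct J (P * T * P) s
    have hP : ‖P‖ ≤ 1 := W.starProjection_norm_le
    have e1 : φ X - φ (P * X' * P) = (φ X - φ (P * X * P)) + φ (P * (X - X') * P) := by
      rw [mul_sub, sub_mul, map_sub]; ring
    rw [e1]
    refine (norm_add_le _ _).trans (add_le_add ((h₃' X).trans ?_) ((φ.le_opNorm _).trans ?_))
    · gcongr; exact hM s hs
    · gcongr
      calc ‖P * (X - X') * P‖ ≤ ‖P‖ * ‖X - X'‖ * ‖P‖ :=
            (norm_mul_le _ _).trans (by gcongr; exact norm_mul_le _ _)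
        _ ≤ 1 * κ * 1 := by gcongr; exact (hz s hs).2
        _ = κ := by ring
  rw [← norm_le_zero_iff]
  have hlim : Tendsto (fun κ : ℝ => 2 * Real.pi * R * (κ * M + ‖φ‖ * κ)) (𝓝[>] 0) (𝓝 0) := by
    have : Continuous fun κ : ℝ => 2 * Real.pi * R * (κ * M + ‖φ‖ * κ) := by fun_prop
    simpa using (this.tendsto 0).mono_left nhdsWithin_le_nhds
  exact ge_of_tendsto hlim (eventually_mem_nhdsWithin.mono fun κ hκ => key κ hκ)

end Residue

/-! ### Boundary values of the sandwiched resolvent. -/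

section Boundary

variable {H K : Type*} [NormedAddCommGroup H] [InnerProductSpace ℂ H] [CompleteSpace H]
  [NormedAddCommGroup K] [InnerProductSpace ℂ K] [CompleteSpace K]

theorem coe_imaginaryPart (A : K →L[ℂ] K) :
    (imaginaryPart A : K →L[ℂ] K) = (2 * Complex.I)⁻¹ • (A - star A) := by
  rw [imaginaryPart_apply_coe, ← Complex.coe_smul, smul_smul]
  congr 1
  push_cast
  rw [mul_inv, Complex.inv_I]
  ring

theorem continuous_coe_imaginaryPart :
    Continuous fun A : K →L[ℂ] K => (imaginaryPart A : K →L[ℂ] K) := by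
  simp only [coe_imaginaryPart]
  fun_prop

theorem inner_imaginaryPart (A : K →L[ℂ] K) (x : K) :
    ⟪x, (imaginaryPart A : K →L[ℂ] K) x⟫_ℂ = ((⟪x, A x⟫_ℂ).im : ℂ) := by
  rw [coe_imaginaryPart, smul_apply, inner_smul_right, sub_apply, inner_sub_right,
    ContinuousLinearMap.star_eq_adjoint, ContinuousLinearMap.adjoint_inner_right,
    ← inner_conj_symm (A x) x, Complex.sub_conj]
  field_simp
  push_cast
  ring

omit [CompleteSpace K] in
/-- The second resolvent identity makes `1 + c J A` invertible. -/
theorem mul_eq_one_of_resolvent_identity {A B J : K →L[ℂ] K} {c : ℂ} (h1 : B = A - c • (A * J * B))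
    (h2 : A = B + c • (B * J * A)) :
    (1 + c • (J * A)) * (1 - c • (J * B)) = 1 ∧ (1 - c • (J * B)) * (1 + c • (J * A)) = 1 ∧
      B = A * (1 - c • (J * B)) := by
  refine ⟨?_, ?_, ?_⟩
  · have : (1 + c • (J * A)) * (1 - c • (J * B)) = 1 + c • (J * (A - c • (A * J * B) - B)) := by
      simp only [mul_sub, add_mul, mul_one, one_mul, smul_mul_assoc, mul_smul_comm, smul_sub,
        smul_add, mul_assoc]
      abel
    rw [this, ← h1, sub_self, mul_zero, smul_zero, add_zero]
  · have : (1 - c • (J * B)) * (1 + c • (J * A)) = 1 + c • (J * (A - (B + c • (B * J * A)))) := by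
      simp only [mul_add, sub_mul, mul_sub, mul_one, one_mul, smul_mul_assoc, mul_smul_comm, smul_sub,
        smul_add, mul_assoc]
      abel
    rw [this, ← h2, sub_self, mul_zero, smul_zero, add_zero]
  · conv_lhs => rw [h1]
    simp only [mul_sub, mul_one, mul_smul_comm, mul_assoc]

/-- Insert `1 = star L * (1 + c A* J)` and `1 = (1 + c J A) * L` into `A L - L* A*`; since `c` is
real, the terms with `c` cancel. -/
theorem imaginaryPart_mul_inverse {A J L : K →L[ℂ] K} (hJ : IsSelfAdjoint J) {c : ℝ}
    (h1 : (1 + (c : ℂ) • (J * A)) * L = 1) :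
    (imaginaryPart (A * L) : K →L[ℂ] K) = star L * (imaginaryPart A : K →L[ℂ] K) * L := by
  have h2 : star L * (1 + (c : ℂ) • (star A * J)) = 1 := by
    have := congrArg star h1
    rwa [star_mul, star_one, ← Complex.conj_ofReal, ← star_one_add_smul hJ] at this
  rw [coe_imaginaryPart, coe_imaginaryPart, mul_smul_comm, smul_mul_assoc, star_mul]
  congr 1
  calc A * L - star L * star A
      = (star L * (1 + (c : ℂ) • (star A * J))) * A * L -
          star L * star A * ((1 + (c : ℂ) • (J * A)) * L) := by rw [h1, h2, one_mul, mul_one]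
    _ = _ := by
      simp only [mul_add, add_mul, mul_sub, sub_mul, mul_one, one_mul, smul_mul_assoc, mul_smul_comm,
        mul_assoc]
      abel

theorem im_pos_of_mem_Ioi (lam : ℝ) {y : ℝ} (hy : y ∈ Set.Ioi (0 : ℝ)) :
    0 < ((lam : ℂ) + y * Complex.I).im := by
  simpa using hy

section

variable {F : H →L[ℂ] K} {J : K →L[ℂ] K} {H₀ : H →ₗ.[ℂ] H} {lam : ℝ}

theorem resolvent_identity_of_tendsto (hJ : IsSelfAdjoint J) (hH₀ : IsSelfAdjoint H₀) {r s : ℝ}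
    {T T' : K →L[ℂ] K}
    (hT : Tendsto (fun y : ℝ => sandwich F (line F J H₀ r) (lam + y * Complex.I)) (𝓝[>] 0) (𝓝 T))
    (hT' : Tendsto (fun y : ℝ => sandwich F (line F J H₀ s) (lam + y * Complex.I)) (𝓝[>] 0) (𝓝 T')) :
    T' = T - ((s - r : ℝ) : ℂ) • (T * J * T') := by
  refine tendsto_nhds_unique hT' ?_
  refine (hT.sub (((hT.mul_const J).mul hT').const_smul _)).congr' ?_
  exact eventually_mem_nhdsWithin.mono fun y hy =>
    (sandwich_line F hJ hH₀ r s (im_pos_of_mem_Ioi lam hy).ne').symm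

omit [CompleteSpace K] in
theorem add_smul_of_sub_smul {A B J : K →L[ℂ] K} {r s : ℝ}
    (h : A = B - ((r - s : ℝ) : ℂ) • (B * J * A)) : A = B + ((s - r : ℝ) : ℂ) • (B * J * A) := by
  conv_lhs => rw [h]
  rw [sub_eq_add_neg, ← neg_smul, ← Complex.ofReal_neg, neg_sub]

theorem isCompactOperator_sandwich (hF : IsHilbertSchmidt F) (A : H →ₗ.[ℂ] H) (z : ℂ) :
    IsCompactOperator (sandwich F A z) :=
  hF.isCompactOperator.comp_clm (resolventAt A z ∘L F.adjoint)

theorem isCompactOperator_star_sandwich (hF : IsHilbertSchmidt F) (A : H →ₗ.[ℂ] H) (z : ℂ) :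
    IsCompactOperator (star (sandwich F A z) : K →L[ℂ] K) := by
  rw [sandwich, ContinuousLinearMap.star_eq_adjoint, ContinuousLinearMap.adjoint_comp,
    ContinuousLinearMap.adjoint_comp, ContinuousLinearMap.adjoint_adjoint]
  exact hF.isCompactOperator.comp_clm ((resolventAt A z).adjoint ∘L F.adjoint)

theorem tendsto_sandwichIm {A : H →ₗ.[ℂ] H} {T : K →L[ℂ] K}
    (hT : Tendsto (fun y : ℝ => sandwich F A (lam + y * Complex.I)) (𝓝[>] 0) (𝓝 T)) :
    Tendsto (fun y : ℝ => sandwichIm F A (lam + y * Complex.I)) (𝓝[>] 0)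
      (𝓝 (imaginaryPart T : K →L[ℂ] K)) := by
  simp only [sandwichIm_eq]
  exact (continuous_coe_imaginaryPart.tendsto T).comp hT

theorem boundaryIm_eq {A : H →ₗ.[ℂ] H} {T : K →L[ℂ] K}
    (hT : Tendsto (fun y : ℝ => sandwich F A (lam + y * Complex.I)) (𝓝[>] 0) (𝓝 T)) :
    boundaryIm F A lam = (imaginaryPart T : K →L[ℂ] K) :=
  (tendsto_sandwichIm hT).limUnder_eq

omit [CompleteSpace K] in
theorem eq_of_traceNorm_eq_zero {A : K →L[ℂ] K} (hA : traceNorm A = 0) : A = 0 := by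
  ext x
  rw [zero_apply]
  by_contra h
  have hx : x ≠ 0 := fun h0 => h (by rw [h0, map_zero])
  have h1 := enorm_inner_le_traceNorm A (x := (‖x‖⁻¹ : ℂ) • x) (y := (‖A x‖⁻¹ : ℂ) • A x)
    (by simp [norm_smul, hx]) (by simp [norm_smul, h])
  rw [hA, nonpos_iff_eq_zero, enorm_eq_zero] at h1
  simp [hx, h] at h1

/-- A trace-norm limit and an operator-norm limit of the same family agree. -/
theorem eq_of_tendsto_traceNorm {ι : Type*} {l : Filter ι} [l.NeBot] {A : ι → K →L[ℂ] K}
    {B B' : K →L[ℂ] K} (hB : Tendsto A l (𝓝 B))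
    (hB' : Tendsto (fun i => traceNorm (A i - B')) l (𝓝 0)) : B = B' := by
  rw [← sub_eq_zero]
  refine eq_of_traceNorm_eq_zero (le_antisymm ?_ bot_le)
  refine traceNorm_le_iff.2 fun n e f he hf => ?_
  -- The trace norm is a supremum of norm-continuous finite sums, so a bound on each sum survives
  -- the norm limit.
  have h1 : Tendsto (fun i => ∑ k, ‖⟪f k, (A i - B') (e k)⟫_ℂ‖ₑ) l
      (𝓝 (∑ k, ‖⟪f k, (B - B') (e k)⟫_ℂ‖ₑ)) := by
    refine tendsto_finsetSum _ fun k _ => ?_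
    have hc : Continuous fun X : K →L[ℂ] K => ‖⟪f k, (X - B') (e k)⟫_ℂ‖ₑ := by fun_prop
    exact (hc.tendsto B).comp hB
  exact le_of_tendsto_of_tendsto' h1 hB' fun i => sum_enorm_inner_le_traceNorm _ he hf

theorem IsRegularAt.traceNorm_tendsto {A : H →ₗ.[ℂ] H} (h : IsRegularAt F A lam) {T : K →L[ℂ] K}
    (hT : Tendsto (fun y : ℝ => sandwich F A (lam + y * Complex.I)) (𝓝[>] 0) (𝓝 T)) :
    IsTraceClass (imaginaryPart T : K →L[ℂ] K) ∧
      Tendsto (fun y : ℝ => traceNorm (sandwichIm F A (lam + y * Complex.I) -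
        (imaginaryPart T : K →L[ℂ] K))) (𝓝[>] 0) (𝓝 0) := by
  obtain ⟨B, hB, hBt⟩ := h.exists_limit_im
  rw [eq_of_tendsto_traceNorm (tendsto_sandwichIm hT) hBt]
  exact ⟨hB, hBt⟩

/-- For `y > 0` the sandwiched resolvent at `s` is `A y * L y`, with imaginary part `star (L y) * Im
(A y) * L y`. Invertibility at the limit makes `L y` converge in norm, and the ideal property
carries over the trace-norm limit. -/
theorem isRegularAt_of_isUnit (hJ : IsSelfAdjoint J) (hH₀ : IsSelfAdjoint H₀) {r s : ℝ}
    (h : IsRegularAt F (line F J H₀ r) lam) {T : K →L[ℂ] K}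
    (hT : Tendsto (fun y : ℝ => sandwich F (line F J H₀ r) (lam + y * Complex.I)) (𝓝[>] 0) (𝓝 T))
    (hu : IsUnit (1 + ((s - r : ℝ) : ℂ) • (J * T))) : IsRegularAt F (line F J H₀ s) lam := by
  set c : ℂ := ((s - r : ℝ) : ℂ) with hc
  set A : ℝ → K →L[ℂ] K := fun y => sandwich F (line F J H₀ r) (lam + y * Complex.I) with hA
  set B : ℝ → K →L[ℂ] K := fun y => sandwich F (line F J H₀ s) (lam + y * Complex.I) with hB
  set L : ℝ → K →L[ℂ] K := fun y => Ring.inverse (1 + c • (J * A y)) with hL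
  have hcont : ContinuousAt Ring.inverse (1 + c • (J * T)) := by
    obtain ⟨u, hu'⟩ := hu
    rw [← hu']
    exact NormedRing.inverse_continuousAt u
  have hLt : Tendsto L (𝓝[>] 0) (𝓝 (Ring.inverse (1 + c • (J * T)))) :=
    hcont.tendsto.comp (tendsto_const_nhds.add ((hT.const_mul J).const_smul c))
  have hid : ∀ y ∈ Set.Ioi (0 : ℝ), (1 + c • (J * A y)) * L y = 1 ∧ B y = A y * L y := by
    intro y hy
    have hz := (im_pos_of_mem_Ioi lam hy).ne'
    obtain ⟨h1, h2, h3⟩ := mul_eq_one_of_resolvent_identity (sandwich_line F hJ hH₀ r s hz)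
      (add_smul_of_sub_smul (sandwich_line F hJ hH₀ s r hz))
    have : L y = 1 - c • (J * B y) := Ring.inverse_eq_of_mul_eq_one h1 h2
    rw [this]
    exact ⟨h1, h3⟩
  obtain ⟨htc, htt⟩ := h.traceNorm_tendsto hT
  refine ⟨⟨_, (hT.mul hLt).congr' (eventually_mem_nhdsWithin.mono fun y hy => (hid y hy).2.symm)⟩,
    ⟨_, htc.mul_mul (star (Ring.inverse (1 + c • (J * T)))) (Ring.inverse (1 + c • (J * T))), ?_⟩⟩
  refine (tendsto_traceNorm_mul_mul hLt.star hLt htc htt).congr' ?_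
  refine eventually_mem_nhdsWithin.mono fun y hy => ?_
  obtain ⟨h1, h2⟩ := hid y hy
  have h3 : sandwichIm F (line F J H₀ s) (lam + y * Complex.I) =
      star (L y) * sandwichIm F (line F J H₀ r) (lam + y * Complex.I) * L y := by
    rw [sandwichIm_eq, sandwichIm_eq, ← imaginaryPart_mul_inverse hJ h1]
    exact congrArg (fun X => (imaginaryPart X : K →L[ℂ] K)) h2
  simp only [h3]

theorem imaginaryPart_nonneg_of_tendsto {A : H →ₗ.[ℂ] H} (hA : IsMaximalSymmetric A) {T : K →L[ℂ] K}
    (hT : Tendsto (fun y : ℝ => sandwich F A (lam + y * Complex.I)) (𝓝[>] 0) (𝓝 T)) :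
    0 ≤ (imaginaryPart T : K →L[ℂ] K) := by
  rw [ContinuousLinearMap.nonneg_iff_isPositive, ContinuousLinearMap.isPositive_iff_complex]
  intro x
  rw [← inner_conj_symm, inner_imaginaryPart, Complex.conj_ofReal]
  refine ⟨by simp, ?_⟩
  have hc : Continuous fun X : K →L[ℂ] K => (⟪x, X x⟫_ℂ).im := by fun_prop
  have h1 := (hc.tendsto T).comp hT
  have h2 : 0 ≤ (⟪x, T x⟫_ℂ).im := ge_of_tendsto h1 <| eventually_mem_nhdsWithin.mono fun y hy =>
    inner_sandwich_im_nonneg F hA (im_pos_of_mem_Ioi lam hy) x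
  simpa using h2

end

omit [CompleteSpace K] in
theorem IsTraceClass.summable_norm_inner {B : K →L[ℂ] K} (hB : IsTraceClass B) {ι : Type*}
    {b : ι → K} (hb : Orthonormal ℂ b) : Summable fun i => ‖⟪b i, B (b i)⟫_ℂ‖ := by
  refine summable_of_sum_le (c := (traceNorm B).toReal) (fun i => norm_nonneg _) fun s => ?_
  have h1 := sum_enorm_inner_le_traceNorm B (n := s.card) (e := fun i => b (s.equivFin.symm i))
    (f := fun i => b (s.equivFin.symm i))
    (hb.comp _ (Subtype.val_injective.comp s.equivFin.symm.injective))
    (hb.comp _ (Subtype.val_injective.comp s.equivFin.symm.injective))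
  rw [Equiv.sum_comp s.equivFin.symm (fun i : s => ‖⟪b i, B (b i)⟫_ℂ‖ₑ),
    Finset.sum_coe_sort s (fun i => ‖⟪b i, B (b i)⟫_ℂ‖ₑ)] at h1
  have h2 := ENNReal.toReal_mono hB.ne h1
  rw [ENNReal.toReal_sum (fun i _ => enorm_ne_top)] at h2
  simpa using h2

/-- The operator `S` is the positive square root, with `‖S (b i)‖ ^ 2 = ⟪b i, B (b i)⟫`. All bases
are covered so that the basis chosen in `trace` can be used. -/
theorem exists_sqrt {B : K →L[ℂ] K} (hB : 0 ≤ B) (htc : IsTraceClass B) :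
    ∃ S : K →L[ℂ] K, IsSelfAdjoint S ∧ S * S = B ∧
      ∀ {w : Set K} (b : HilbertBasis w ℂ K), Summable fun i => ‖S (b i)‖ ^ 2 := by
  refine ⟨CFC.sqrt B, (CFC.sqrt_nonneg B).isSelfAdjoint, CFC.sqrt_mul_sqrt_self B hB, fun b => ?_⟩
  refine (htc.summable_norm_inner b.orthonormal).congr fun i => ?_
  have hSs : ∀ x y : K, ⟪CFC.sqrt B x, y⟫_ℂ = ⟪x, CFC.sqrt B y⟫_ℂ :=
    ((CFC.sqrt_nonneg B).isSelfAdjoint).isSymmetric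
  have h1 : B (b i) = CFC.sqrt B (CFC.sqrt B (b i)) := by
    rw [← mul_apply_eq_comp, CFC.sqrt_mul_sqrt_self B hB]
  rw [h1, ← hSs, inner_self_eq_norm_sq_to_K]
  simp

end Boundary

/-! ### The continuation formula, the identity theorem and the residue. -/

section Main

variable {H K : Type*} [NormedAddCommGroup H] [InnerProductSpace ℂ H] [CompleteSpace H]
  [NormedAddCommGroup K] [InnerProductSpace ℂ K] [CompleteSpace K]

/-- The inverse of `1 + (s - r) J T` is `L = 1 - (s - r) J T'`, with `T'` the limit at `s`. Reality
of `s - r` identifies the other inverse with `star L`, and cyclicity of the trace concludes. -/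
theorem boundaryTrace_eq {F : H →L[ℂ] K} {J : K →L[ℂ] K} {H₀ : H →ₗ.[ℂ] H} {lam : ℝ}
    (hJ : IsSelfAdjoint J) (hH₀ : IsSelfAdjoint H₀) {r s : ℝ} {T S : K →L[ℂ] K}
    (hT : Tendsto (fun y : ℝ => sandwich F (line F J H₀ r) (lam + y * Complex.I)) (𝓝[>] 0) (𝓝 T))
    (hS : IsSelfAdjoint S) (hST : S * S = (imaginaryPart T : K →L[ℂ] K))
    (hv : Summable fun i => ‖S ((exists_hilbertBasis ℂ K).choose_spec.choose i)‖ ^ 2)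
    (hs : IsRegularAt F (line F J H₀ s) lam) :
    boundaryTrace F J H₀ lam s = (1 / Real.pi : ℂ) *
      vectorTrace _ hv (resolventProduct J T (s - r)) := by
  obtain ⟨T', hT'⟩ := hs.exists_limit
  obtain ⟨h1, h2, h3⟩ := mul_eq_one_of_resolvent_identity
    (resolvent_identity_of_tendsto hJ hH₀ hT hT')
    (add_smul_of_sub_smul (resolvent_identity_of_tendsto hJ hH₀ hT' hT))
  set L := 1 - ((s - r : ℝ) : ℂ) • (J * T') with hL
  have hinv := Ring.inverse_eq_of_mul_eq_one h1 h2
  have hst : 1 + ((s - r : ℝ) : ℂ) • (star T * J) = star (1 + ((s - r : ℝ) : ℂ) • (J * T)) := by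
    rw [star_one_add_smul hJ, Complex.conj_ofReal]
  have hinv' : Ring.inverse (1 + ((s - r : ℝ) : ℂ) • (star T * J)) = star L := by
    rw [hst]
    exact Ring.inverse_eq_of_mul_eq_one (by rw [← star_mul, h2, star_one])
      (by rw [← star_mul, h1, star_one])
  rw [boundaryTrace, boundaryIm_eq hT', h3, imaginaryPart_mul_inverse hJ h1, ← hST,
    resolventProduct, ← Complex.ofReal_sub, hinv, hinv',
    ← tsum_inner_conj_eq_vectorTrace (exists_hilbertBasis ℂ K).choose_spec.choose hS hv L J hJ]
  rfl

theorem meromorphic_resolventProduct {J T : K →L[ℂ] K} (h1 : IsCompactOperator (J * T : K →L[ℂ] K))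
    (h2 : IsCompactOperator (star T * J : K →L[ℂ] K)) : Meromorphic (resolventProduct J T) :=
  fun s => ((h1.meromorphicAt_inverse s).1.mul_normedAlgebra (MeromorphicAt.const J s)).mul_normedAlgebra
    (h2.meromorphicAt_inverse s).1

/-- The identity theorem for meromorphic functions on the plane. -/
theorem _root_.Meromorphic.eventuallyEq_of_frequently {f g : ℂ → ℂ} (hf : Meromorphic f)
    (hg : Meromorphic g) {x : ℂ} (h : ∃ᶠ z in 𝓝[≠] x, f z = g z) (y : ℂ) : f =ᶠ[𝓝[≠] y] g := by
  have hd := hf.sub hg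
  have hx : meromorphicOrderAt (f - g) x = ⊤ := by
    rcases (hd x).eventually_eq_zero_or_eventually_ne_zero with h0 | h0
    · exact meromorphicOrderAt_eq_top_iff.2 h0
    · exact absurd h (not_frequently.2 (h0.mono fun z hz he => hz (by simp [he])))
  have hy : meromorphicOrderAt (f - g) y = ⊤ := by
    by_contra hy
    exact (hd.exists_meromorphicOrderAt_ne_top_iff_forall.1 ⟨y, hy⟩) x hx
  exact (meromorphicOrderAt_eq_top_iff.1 hy).mono fun z hz => sub_eq_zero.1 hz

theorem frequently_punctured_of_eventually_ofReal {p : ℂ → Prop} {r : ℝ}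
    (h : ∀ᶠ s : ℝ in 𝓝 r, p s) : ∃ᶠ z in 𝓝[≠] (r : ℂ), p z := by
  have hmap : Tendsto (fun s : ℝ => (s : ℂ)) (𝓝[≠] r) (𝓝[≠] (r : ℂ)) :=
    tendsto_nhdsWithin_of_tendsto_nhds_of_eventually_within _
      (Complex.continuous_ofReal.continuousAt.mono_left nhdsWithin_le_nhds)
      (eventually_mem_nhdsWithin.mono fun s hs h => hs (Complex.ofReal_injective h))
  exact hmap.frequently (h.filter_mono nhdsWithin_le_nhds).frequently

theorem hasResidueAt_zero_of_circleIntegral {G G₀ : ℂ → ℂ} {a : ℂ} (h : G =ᶠ[𝓝[≠] a] G₀)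
    {p : ℂ → Prop} (hp : ∀ᶠ s in 𝓝[≠] a, p s)
    (h0 : ∀ ε > 0, (∀ s ∈ Metric.sphere a ε, p s) → (∮ s in C(a, ε), G₀ s) = 0) :
    HasResidueAt G a 0 := by
  obtain ⟨δ, hδ, hball⟩ := Metric.mem_nhdsWithin_iff.1 (h.and hp)
  rw [HasResidueAt]
  filter_upwards [Ioo_mem_nhdsGT hδ] with ε hε
  have hs : ∀ s ∈ Metric.sphere a ε, G s = G₀ s ∧ p s := fun s hs => hball
    ⟨Metric.mem_ball.2 ((Metric.mem_sphere.1 hs).trans_lt hε.2),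
      fun hsa => hε.1.ne' (by rw [← Metric.mem_sphere.1 hs, Set.mem_singleton_iff.1 hsa, dist_self])⟩
  rw [circleIntegral.integral_congr hε.1.le fun s h => (hs s h).1, h0 ε hε.1 fun s h => (hs s h).2,
    mul_zero]

theorem circleIntegral_comp_sub (f : ℂ → ℂ) (a b : ℂ) (R : ℝ) :
    (∮ s in C(a, R), f (s - b)) = ∮ s in C(a - b, R), f s := by
  simp only [circleIntegral, deriv_circleMap]
  refine intervalIntegral.integral_congr fun θ _ => ?_
  simp [circleMap, add_sub_right_comm]

end Main

end FramedHilbert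

open FramedHilbert in
theorem mainTheorem10 {H K : Type*}
    [NormedAddCommGroup H] [InnerProductSpace ℂ H] [CompleteSpace H]
    [TopologicalSpace.SeparableSpace H]
    [NormedAddCommGroup K] [InnerProductSpace ℂ K] [CompleteSpace K]
    (F : H →L[ℂ] K) (hF : FramedHilbert.IsFrame F)
    (H₀ : H →ₗ.[ℂ] H) (hH₀ : IsSelfAdjoint H₀)
    (J : K →L[ℂ] K) (hJ : IsSelfAdjoint J)
    (lam : ℝ) (hline : FramedHilbert.IsRegularLine F J H₀ lam) :
    (∃ G : ℂ → ℂ, FramedHilbert.IsMeromorphicContinuation F J H₀ lam G) ∧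
      ∀ G : ℂ → ℂ, FramedHilbert.IsMeromorphicContinuation F J H₀ lam G →
        ∀ s₀ : ℝ, FramedHilbert.HasResidueAt G s₀ 0 := by
  obtain ⟨r, hr⟩ := hline
  obtain ⟨T, hT⟩ := hr.exists_limit
  have hTc : IsCompactOperator T := isCompactOperator_of_tendsto hT
    (.of_forall fun y => isCompactOperator_sandwich hF.hilbertSchmidt _ _)
  have hTc' : IsCompactOperator (star T : K →L[ℂ] K) := isCompactOperator_of_tendsto hT.star
    (.of_forall fun y => isCompactOperator_star_sandwich hF.hilbertSchmidt _ _)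
  have hJT : IsCompactOperator (J * T : K →L[ℂ] K) := hTc.clm_comp J
  have hTJ : IsCompactOperator (star T * J : K →L[ℂ] K) := hTc'.comp_clm J
  obtain ⟨S, hS, hSS, hsum⟩ := exists_sqrt
    (imaginaryPart_nonneg_of_tendsto (isMaximalSymmetric_line F hJ hH₀ r) hT)
    (hr.traceNorm_tendsto hT).1
  have hv := hsum (exists_hilbertBasis ℂ K).choose_spec.choose
  set φ := vectorTrace _ hv with hφ
  set G₀ : ℂ → ℂ := fun s => (1 / Real.pi : ℂ) * φ (resolventProduct J T (s - r)) with hG₀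
  have hmer : IsMeromorphicContinuation F J H₀ lam G₀ := by
    refine ⟨fun s => ?_, fun s hs => (boundaryTrace_eq hJ hH₀ hT hS hSS hv hs).symm⟩
    have h1 : Meromorphic fun s : ℂ => resolventProduct J T (s - r) :=
      Meromorphic.meromorphic_fun_comp_sub_const_iff_meromorphic.2 (meromorphic_resolventProduct hJT hTJ)
    exact (MeromorphicAt.const _ s).mul ((h1 s).clm_apply_const φ)
  refine ⟨⟨G₀, hmer⟩, fun G hG s₀ => ?_⟩
  -- The operator `1 + (s - r) J T` equals `1` at `s = r`, so it stays invertible nearby; regular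
  -- points thus accumulate at `r`, as the identity theorem requires.
  have hreg : ∀ᶠ s : ℝ in 𝓝 r, IsRegularAt F (line F J H₀ s) lam := by
    have hc : Continuous fun s : ℝ => 1 + ((s - r : ℝ) : ℂ) • (J * T) := by fun_prop
    filter_upwards [(Units.isOpen.preimage hc).mem_nhds (by simp)] with s hs
    exact isRegularAt_of_isUnit hJ hH₀ hr hT hs
  have heq := hG.meromorphic.eventuallyEq_of_frequently hmer.meromorphic
    (frequently_punctured_of_eventually_ofReal (p := fun z => G z = G₀ z) (hreg.mono fun s hs =>
      (hG.eq_boundaryTrace s hs).trans (hmer.eq_boundaryTrace s hs).symm)) s₀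
  have hunit : ∀ᶠ s : ℂ in 𝓝[≠] (s₀ : ℂ), IsUnit (1 + (s - r) • (J * T)) := by
    have h1 := (hJT.meromorphicAt_inverse ((s₀ : ℂ) - r)).2
    have h2 : Tendsto (fun s : ℂ => s - r) (𝓝[≠] (s₀ : ℂ)) (𝓝[≠] ((s₀ : ℂ) - r)) :=
      tendsto_nhdsWithin_of_tendsto_nhds_of_eventually_within _
        ((continuous_id.sub continuous_const).continuousAt.mono_left nhdsWithin_le_nhds)
        (eventually_mem_nhdsWithin.mono fun s hs h => hs (sub_left_injective h))
    exact h2.eventually h1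
  refine hasResidueAt_zero_of_circleIntegral heq hunit fun ε hε hs => ?_
  rw [hG₀, circleIntegral.integral_const_mul,
    circleIntegral_comp_sub (fun s => φ (resolventProduct J T s)), ← Complex.ofReal_sub,
    circleIntegral_vectorTrace_eq_zero _ hS hv hJ (hSS.trans (coe_imaginaryPart T)) hTc hTc' _ hε
      fun s h => ?_, mul_zero]
  have h3 := hs (s + r) (by
    rw [mem_sphere_iff_norm] at h ⊢
    rw [← h]
    congr 1
    push_cast
    ring)
  rwa [add_sub_cancel_right] at h3
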